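/- Fix $\delta>0$. Functions on the lattice $\delta\mathbb{Z}$ are written $f=(f_\kappa)_{\kappa\in\mathbb{Z}}$, where $\kappa$ stands for the point $\delta\kappa$, and $(\Delta^\delta f)_\kappa=\delta^{-2}(f_{\kappa+1}+f_{\kappa-1}-2f_\kappa)$. Let $$\mathcal{P}_{2,c}^\delta=\Big\{\rho\in\ell^1(\mathbb{Z})\ \Big|\ \rho_\kappa\ge0\ \forall\kappa,\ \ \delta\sum_\kappa\rho_\kappa=1,\ \ \delta\sum_\kappa(\delta\kappa)^2\rho_\kappa<\infty,\ \ \delta\sum_\kappa(\delta\kappa)\rho_\kappa=0\Big\}.$$ For $p\in\mathbb{R}$ and $r\ge0$ read $p^2/r$ as $0$ if $r=p=0$ and as $+\infty$ if $r=0\neq p$. For $\hat\rho,\check\rho\in\mathcal{P}_{2,c}^\delta$ let $\mathcal{C}(\hat\rho,\check\rho)$ be the set of pairs of curves $\rho:[0,1]\to\mathcal{P}_{2,c}^\delta$, $\mathfrak{w}:[0,1]\to\ell^2(\mathbb{Z})$ such that $\rho_\kappa\in H^1([0,1])$ (continuous representative) and $\mathfrak{w}_\kappa\in L^2([0,1])$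 for every $\kappa\in\mathbb{Z}$, such that $\dot\rho_\kappa(s)=(\Delta^\delta\mathfrak{w}(s))_\kappa$ for every $\kappa$ and almost every $s\in[0,1]$, and such that $\rho(0)=\hat\rho$, $\rho(1)=\check\rho$. Define the discrete diffusive transport distance $\mathbb{D}(\hat\rho,\check\rho)\in[0,\infty]$ by $$\mathbb{D}(\hat\rho,\check\rho)^2=\inf_{(\rho,\mathfrak{w})\in\mathcal{C}(\hat\rho,\check\rho)}\mathfrak{A}^\delta(\rho,\mathfrak{w}),\qquad \mathfrak{A}^\delta(\rho,\mathfrak{w})=\int_0^1\delta\sum_{\kappa\in\mathbb{Z}}\frac{\mathfrak{w}_\kappa(s)^2}{\rho_\kappa(s)}\,ds,$$ with $\inf\emptyset=+\infty$. **Theorem.** Let $\rho^*\in\mathcal{P}_{2,c}^\delta$ and $A(\rho^*)=\{\rho\in\mathcal{P}_{2,c}^\delta\mid\mathbb{D}(\rho,\rho^*)<\infty\}$. Then: 1. $\mathbb{D}$ is a metric on $A(\rho^*)$: for all $\rho^0,\rho^1,\rho^2\in A(\rho^*)$ one has $\mathbb{D}(\rho^0,\rho^1)<\infty$; $\mathbb{D}(\rho^0,\rho^1)=0$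 if and only if $\rho^0=\rho^1$; $\mathbb{D}(\rho^0,\rho^1)=\mathbb{D}(\rho^1,\rho^0)$; and $\mathbb{D}(\rho^0,\rho^2)\le\mathbb{D}(\rho^0,\rho^1)+\mathbb{D}(\rho^1,\rho^2)$. 2. For all $\rho^0,\rho^1\in A(\rho^*)$ there is a pair $(\rho,\mathfrak{w})\in\mathcal{C}(\rho^0,\rho^1)$ that minimizes $\mathfrak{A}^\delta$ on $\mathcal{C}(\rho^0,\rho^1)$, so that $\mathfrak{A}^\delta(\rho,\mathfrak{w})=\mathbb{D}(\rho^0,\rho^1)^2$, and the curve $\rho$ is a geodesic in $A(\rho^*)$: $\rho(s)\in A(\rho^*)$ and $\mathbb{D}(\rho(s),\rho(t))=|s-t|\,\mathbb{D}(\rho^0,\rho^1)$ for all $s,t\in[0,1]$. -/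

import Mathlib

open MeasureTheory Set
open scoped ENNReal

noncomputable section

namespace DiffusiveTransport

/-- The discrete Laplacian `(f (κ + 1) + f (κ - 1) - 2 f κ) / δ²`.  Functions on the lattice `δℤ`
are indexed by `κ : ℤ`, with `κ` standing for the lattice point `δκ`. -/
def laplacian (δ : ℝ) (f : ℤ → ℝ) (κ : ℤ) : ℝ :=
  (f (κ + 1) + f (κ - 1) - 2 * f κ) / δ ^ 2

/-- Absolutely summable functions on the lattice with finite second moment and vanishing first
moment. (The series of first moments converges absolutely under the first two conditions.) -/
def ell1TwoC (δ : ℝ) : Set (ℤ → ℝ) :=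
  {f | Memℓp f 1 ∧ (Summable fun κ : ℤ => (δ * κ) ^ 2 * |f κ|) ∧
    δ * ∑' κ : ℤ, (δ * κ) * f κ = 0}

/-- Centred probability densities of finite second moment on the lattice. -/
def densities (δ : ℝ) : Set (ℤ → ℝ) :=
  {ρ | ρ ∈ ell1TwoC δ ∧ (∀ κ, 0 ≤ ρ κ) ∧ δ * ∑' κ : ℤ, ρ κ = 1}

/-- The quotient `p² / r`, read as `0` for `r = p = 0` and as `+∞` for `r = 0 ≠ p`.
(The value for `r < 0` is irrelevant, it is set to `+∞`.) -/
def quot (p r : ℝ) : ℝ≥0∞ :=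
  open Classical in
  if 0 < r then ENNReal.ofReal (p ^ 2 / r) else if r = 0 ∧ p = 0 then 0 else ⊤

/-- `f` is (the continuous representative of) an element of the Sobolev space `H¹([0,1])`:
it is absolutely continuous on `[0,1]`, with square integrable derivative. -/
def IsH1 (f : ℝ → ℝ) : Prop :=
  AbsolutelyContinuousOnInterval f 0 1 ∧ MemLp (deriv f) 2 (volume.restrict (Icc 0 1))

/-- The admissible pairs `(ρ, w)`: curves `ρ` of centred probability densities and curves `w`
in `ℓ²`, parametrized by `s ∈ [0,1]` (values at other `s` are irrelevant), such that every
component `ρ_κ` is in `H¹([0,1])`, every component `w_κ` is in `L²([0,1])`, and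
`d/ds ρ_κ = (Δ w)_κ` at almost every `s ∈ [0,1]`. -/
structure IsAdmissible (δ : ℝ) (ρ w : ℝ → ℤ → ℝ) : Prop where
  mem_densities : ∀ s ∈ Icc (0 : ℝ) 1, ρ s ∈ densities δ
  mem_ell2 : ∀ s ∈ Icc (0 : ℝ) 1, Memℓp (w s) 2
  isH1 : ∀ κ, IsH1 fun s => ρ s κ
  memL2 : ∀ κ, MemLp (fun s => w s κ) 2 (volume.restrict (Icc 0 1))
  diffusion_eq : ∀ κ, ∀ᵐ s ∂(volume.restrict (Icc (0 : ℝ) 1)),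
    HasDerivAt (fun t => ρ t κ) (laplacian δ (w s) κ) s

/-- The admissible pairs that connect `a` to `b`. -/
def connections (δ : ℝ) (a b : ℤ → ℝ) : Set ((ℝ → ℤ → ℝ) × (ℝ → ℤ → ℝ)) :=
  {c | IsAdmissible δ c.1 c.2 ∧ c.1 0 = a ∧ c.1 1 = b}

/-- The action `∫₀¹ δ ∑_κ w_κ(s)² / ρ_κ(s) ds`, an element of `[0, ∞]`. -/
def action (δ : ℝ) (c : (ℝ → ℤ → ℝ) × (ℝ → ℤ → ℝ)) : ℝ≥0∞ :=
  ∫⁻ s in Icc (0 : ℝ) 1, ENNReal.ofReal δ * ∑' κ : ℤ, quot (c.2 s κ) (c.1 s κ)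

/-- The discrete diffusive transport distance, the square root of the infimum of the action; it is
`∞` if no admissible pair of finite action connects the two densities. -/
def diffDist (δ : ℝ) (a b : ℤ → ℝ) : ℝ≥0∞ :=
  (⨅ c ∈ connections δ a b, action δ c) ^ (1 / 2 : ℝ)

/-- The densities at finite distance from `ρstar`. -/
def finiteSet (δ : ℝ) (ρstar : ℤ → ℝ) : Set (ℤ → ℝ) :=
  {ρ | ρ ∈ densities δ ∧ diffDist δ ρ ρstar < ∞}

end DiffusiveTransport

end

noncomputable section

namespace DiffusiveTransport

open Filter Topology

/-! ### The quotient `p² / r` as a supremum of affine functions -/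

/-! The quotient `p² / r` is a supremum of affine functions of `(p, r)` (`quot_eq_iSup`), hence
jointly convex and lower semicontinuous. The equation is linear and, integrated in time, survives
restriction, gluing and affine changes of time. A path of duration `x` and action at most `x`
witnesses distance at most `x`; since durations and actions both add under gluing, the triangle
inequality follows, and symmetry is time reversal.

Two bounds give control by the action: `2|w| ≤ w² / ρ + ρ` and unit mass bound the space-time `L¹`
norm of `w`, while `ρ ≤ 1/δ` bounds its `L²` norm. Testing the equation with a point mass and using
the first bound shows that distance zero forces equality; testing with a truncated square (`cutSq`)
shows that second moments stay bounded, uniformly among paths with the same start and bounded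
action.

For existence, the `w`-components of almost minimal paths form nested, bounded, midpoint-convex
subsets of a Hilbert space. Elements of nearly least norm form a Cauchy sequence by the
parallelogram law (`exists_cauchySeq_of_midpoint`), so strong convergence comes without weak
compactness. As `ρ` is determined by its start and `w`, it converges pointwise; the moment bound
keeps mass and centre in the limit (`exists_limit_path`), and Fatou gives lower semicontinuity of
the action.

A minimizer is a geodesic because cutting it into three pieces forces equality in both
Cauchy-Schwarz and the triangle inequality (`eq_mul_of_sq_le_mul`). -/

lemma ofReal_le_quot (p r l : ℝ) : ENNReal.ofReal (2 * l * p - l ^ 2 * r) ≤ quot p r := by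
  unfold quot
  split_ifs with h h'
  · apply ENNReal.ofReal_le_ofReal
    rw [le_div_iff₀ h]
    nlinarith [sq_nonneg (p - l * r)]
  · obtain ⟨rfl, rfl⟩ := h'
    simp
  · exact le_top

/-- For `r > 0` the optimal slope is `l = p / r`. In the degenerate cases the supremum is infinite
exactly where the convention says so; the value `⊤` for `r < 0` is what makes the identity hold
without a sign condition. -/
lemma quot_eq_iSup (p r : ℝ) :
    quot p r = ⨆ l : ℝ, ENNReal.ofReal (2 * l * p - l ^ 2 * r) := by
  apply le_antisymm _ (iSup_le fun l => ofReal_le_quot p r l)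
  rcases lt_trichotomy r 0 with hr | rfl | hr
  · rw [quot, if_neg (by linarith), if_neg (by rintro ⟨h, -⟩; linarith), top_le_iff]
    refine ENNReal.eq_top_of_forall_nnreal_le fun x => ?_
    have hr' : 0 < -r := by linarith
    -- Chosen so that in the product `l * (2 * p + l * (-r))` the first factor is at least `1` and
    -- the second at least `x`.
    obtain ⟨l, hl⟩ : ∃ l, l = (x + 1 + 2 * |p|) / (-r) + 1 := ⟨_, rfl⟩
    refine le_trans ?_ (le_iSup _ l)
    have hl1 : 1 ≤ l := by
      rw [hl]
      have : 0 ≤ (x + 1 + 2 * |p|) / (-r) := by positivity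
      linarith
    have hl2 : l * (-r) = x + 1 + 2 * |p| + (-r) := by
      rw [hl, add_mul, div_mul_cancel₀ _ hr'.ne', one_mul]
    have : (x : ℝ) ≤ 2 * l * p - l ^ 2 * r := by
      have : 2 * l * p - l ^ 2 * r = l * (2 * p + l * (-r)) := by ring
      rw [this, hl2]
      have := neg_abs_le p
      have : (0 : ℝ) ≤ x := x.2
      nlinarith
    rw [← ENNReal.ofReal_coe_nnreal]
    exact ENNReal.ofReal_le_ofReal this
  · by_cases hp : p = 0
    · simp [quot, hp]
    · rw [quot, if_neg (lt_irrefl _), if_neg (by simp [hp]), top_le_iff]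
      refine ENNReal.eq_top_of_forall_nnreal_le fun x => ?_
      refine le_trans ?_ (le_iSup _ ((x : ℝ) / (2 * p)))
      rw [← ENNReal.ofReal_coe_nnreal]
      apply ENNReal.ofReal_le_ofReal
      have : 2 * (x / (2 * p)) * p - (x / (2 * p)) ^ 2 * 0 = (x : ℝ) := by
        field_simp
        ring
      exact this.ge
  · refine le_trans ?_ (le_iSup _ (p / r))
    rw [quot, if_pos hr]
    apply ENNReal.ofReal_le_ofReal
    field_simp
    linarith

lemma lowerSemicontinuous_quot : LowerSemicontinuous fun z : ℝ × ℝ => quot z.1 z.2 := by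
  simp_rw [quot_eq_iSup]
  exact lowerSemicontinuous_iSup fun l => Continuous.lowerSemicontinuous
    (ENNReal.continuous_ofReal.comp (by fun_prop))

lemma measurable_quot : Measurable fun z : ℝ × ℝ => quot z.1 z.2 :=
  lowerSemicontinuous_quot.measurable

lemma quot_le_liminf {p r : ℕ → ℝ} {p₀ r₀ : ℝ} (hp : Tendsto p atTop (𝓝 p₀))
    (hr : Tendsto r atTop (𝓝 r₀)) :
    quot p₀ r₀ ≤ liminf (fun n => quot (p n) (r n)) atTop := by
  have h := lowerSemicontinuous_quot (p₀, r₀)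
  refine le_of_forall_lt fun y hy => ?_
  obtain ⟨y', h1, h2⟩ := exists_between hy
  refine lt_of_lt_of_le h1 (le_liminf_of_le ?_ ?_)
  · isBoundedDefault
  · filter_upwards [(hp.prodMk_nhds hr).eventually (h y' h2)] with n hn using hn.le

lemma quot_mid_le (p q r s : ℝ) :
    quot ((p + q) / 2) ((r + s) / 2) ≤ (quot p r + quot q s) / 2 := by
  rw [quot_eq_iSup ((p + q) / 2)]
  refine iSup_le fun l => ?_
  have : 2 * l * ((p + q) / 2) - l ^ 2 * ((r + s) / 2)
      = ((2 * l * p - l ^ 2 * r) + (2 * l * q - l ^ 2 * s)) / 2 := by ring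
  rw [this, ENNReal.ofReal_div_of_pos two_pos, ENNReal.ofReal_ofNat]
  gcongr
  exact ENNReal.ofReal_add_le.trans (add_le_add (ofReal_le_quot _ _ _) (ofReal_le_quot _ _ _))

lemma quot_anti (p : ℝ) {r s : ℝ} (h : r ≤ s) : quot p s ≤ quot p r := by
  rw [quot_eq_iSup p s]
  refine iSup_le fun l => le_trans (ENNReal.ofReal_le_ofReal ?_) (ofReal_le_quot p r l)
  nlinarith [sq_nonneg l]

lemma quot_zero_left {r : ℝ} (hr : 0 ≤ r) : quot 0 r = 0 := by
  rcases hr.eq_or_lt with rfl | h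
  · simp [quot]
  · simp [quot, h]

lemma quot_mul_left {m : ℝ} (hm : m ≠ 0) (p r : ℝ) :
    quot (m * p) r = ENNReal.ofReal (m ^ 2) * quot p r := by
  unfold quot
  split_ifs with h1 h2 h3 h3
  · rw [← ENNReal.ofReal_mul (sq_nonneg _)]; congr 1; ring
  · simp
  · simp_all
  · simp_all
  · rw [ENNReal.mul_top]; simp [hm]

/-- The affine minorants with slopes `l = 1` and `l = -1`. -/
lemma two_mul_enorm_le_quot_add (p r : ℝ) :
    2 * ‖p‖ₑ ≤ quot p r + ENNReal.ofReal r := by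
  have h : ∀ e : ℝ, e ^ 2 = 1 → ENNReal.ofReal (2 * (e * p)) ≤ quot p r + ENNReal.ofReal r := by
    intro e he
    have := ofReal_le_quot p r e
    calc ENNReal.ofReal (2 * (e * p)) = ENNReal.ofReal ((2 * e * p - e ^ 2 * r) + r) := by
          congr 1; rw [he]; ring
      _ ≤ _ := ENNReal.ofReal_add_le.trans (by gcongr)
  have h2 : (2 : ℝ≥0∞) * ‖p‖ₑ = ENNReal.ofReal (2 * |p|) := by
    rw [ENNReal.ofReal_mul two_pos.le, ENNReal.ofReal_ofNat, ← Real.enorm_eq_ofReal_abs]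
  rw [h2]
  rcases abs_choice p with hp | hp <;> rw [hp]
  · simpa using h 1 (by norm_num)
  · simpa using h (-1) (by norm_num)

lemma ofReal_mul_enorm_sq_le_quot {p r c : ℝ} (hc : 0 < c) (hr : r ≤ c⁻¹) :
    ENNReal.ofReal c * ‖p‖ₑ ^ 2 ≤ quot p r := by
  refine le_trans (le_of_eq ?_) (quot_anti p hr)
  rw [quot, if_pos (by positivity), Real.enorm_eq_ofReal_abs, ← ENNReal.ofReal_pow (abs_nonneg _),
    ← ENNReal.ofReal_mul hc.le, sq_abs, div_inv_eq_mul, mul_comm]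

/-! ### Cauchy sequences in nested midpoint-convex sets -/

/-- In an inner product space, a decreasing sequence of nonempty bounded sets that are closed under
midpoints contains a Cauchy sequence of representatives. -/
lemma exists_cauchySeq_of_midpoint {H : Type*} [NormedAddCommGroup H] [InnerProductSpace ℝ H]
    (K : ℕ → Set H) (hne : ∀ n, (K n).Nonempty) (hanti : Antitone K) (C : ℝ)
    (hC : ∀ x ∈ K 0, ‖x‖ ≤ C) (hmid : ∀ n, ∀ x ∈ K n, ∀ y ∈ K n, (1 / 2 : ℝ) • (x + y) ∈ K n) :
    ∃ x : ℕ → H, (∀ n, x n ∈ K n) ∧ CauchySeq x := by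
  set d : ℕ → ℝ := fun n => sInf ((fun x => ‖x‖ ^ 2) '' K n) with hd
  have hbdd : ∀ n, BddBelow ((fun x : H => ‖x‖ ^ 2) '' K n) := fun n =>
    ⟨0, by rintro _ ⟨x, -, rfl⟩; positivity⟩
  have hle : ∀ n, ∀ x ∈ K n, d n ≤ ‖x‖ ^ 2 := fun n x hx => csInf_le (hbdd n) ⟨x, hx, rfl⟩
  have hmono : Monotone d := fun m n h =>
    csInf_le_csInf (hbdd m) ((hne n).image _) (image_mono (hanti h))
  have hdC : BddAbove (range d) := by
    refine ⟨C ^ 2, ?_⟩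
    rintro _ ⟨n, rfl⟩
    obtain ⟨x, hx⟩ := hne n
    have := hC x (hanti (Nat.zero_le n) hx)
    exact (hle n x hx).trans (by gcongr)
  have hlim := tendsto_atTop_ciSup hmono hdC
  set D := ⨆ n, d n
  have hx : ∀ n : ℕ, ∃ x ∈ K n, ‖x‖ ^ 2 < d n + 1 / ((n : ℝ) + 1) := by
    intro n
    obtain ⟨_, ⟨x, hx, rfl⟩, h⟩ := exists_lt_of_csInf_lt ((hne n).image _)
      (lt_add_of_pos_right (d n) (Nat.one_div_pos_of_nat (n := n) (α := ℝ)))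
    exact ⟨x, hx, h⟩
  choose x hxK hxd using hx
  refine ⟨x, hxK, ?_⟩
  -- The midpoint of `x n` and `x m` lies in `K N`, so its squared norm is at least `d N`, whereas
  -- both squared norms are at most `D + 1 / (N + 1)`; the parallelogram law bounds the distance.
  have key : ∀ N n m, N ≤ n → N ≤ m →
      dist (x n) (x m) ≤ √(4 * (D - d N) + 4 * (1 / ((N : ℝ) + 1))) := by
    intro N n m hn hm
    rw [dist_eq_norm]
    apply Real.le_sqrt_of_sq_le
    have h1 := parallelogram_law_with_norm ℝ (x n) (x m)
    have h2 := hle N _ (hmid N _ (hanti hn (hxK n)) _ (hanti hm (hxK m)))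
    rw [norm_smul, mul_pow] at h2
    norm_num at h2
    have h3 := hxd n
    have h4 := hxd m
    have h5 := le_ciSup hdC n
    have h6 := le_ciSup hdC m
    have h7 := one_div_le_one_div_of_le (by positivity : (0 : ℝ) < N + 1)
      (by gcongr : (N : ℝ) + 1 ≤ n + 1)
    have h8 := one_div_le_one_div_of_le (by positivity : (0 : ℝ) < N + 1)
      (by gcongr : (N : ℝ) + 1 ≤ m + 1)
    change d n ≤ D at h5
    change d m ≤ D at h6
    nlinarith
  refine cauchySeq_of_le_tendsto_0' (fun N => √(4 * (D - d N) + 4 * (1 / ((N : ℝ) + 1))))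
    (fun n m h => key n n m le_rfl h) ?_
  have h0 : Tendsto (fun N : ℕ => 4 * (D - d N) + 4 * (1 / ((N : ℝ) + 1))) atTop
      (𝓝 (4 * (D - D) + 4 * 0)) :=
    ((tendsto_const_nhds.sub hlim).const_mul 4).add
      (tendsto_one_div_add_atTop_nhds_zero_nat.const_mul 4)
  simpa using h0.sqrt

variable {δ α β γ : ℝ} {ρ w : ℝ → ℤ → ℝ} {a b : ℤ → ℝ}

/-! ### Paths over a general time interval, in integrated form -/

/-- Solutions of `ρ' = Δ w` on `[α, β]`, in integrated form. -/
structure IsPath (δ α β : ℝ) (ρ w : ℝ → ℤ → ℝ) : Prop where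
  mem_densities : ∀ s ∈ Icc α β, ρ s ∈ densities δ
  mem_ell2 : ∀ s ∈ Icc α β, Memℓp (w s) 2
  memL2 : ∀ κ, MemLp (fun s => w s κ) 2 (volume.restrict (Icc α β))
  integral_eq : ∀ κ, ∀ s ∈ Icc α β, ∀ t ∈ Icc α β,
    ρ t κ - ρ s κ = ∫ u in s..t, laplacian δ (w u) κ

/-- The action of a pair over a set of times. -/
def actionOn (δ : ℝ) (S : Set ℝ) (ρ w : ℝ → ℤ → ℝ) : ℝ≥0∞ :=
  ∫⁻ s in S, ENNReal.ofReal δ * ∑' κ : ℤ, quot (w s κ) (ρ s κ)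

lemma laplacian_smul (δ m : ℝ) (f : ℤ → ℝ) (κ : ℤ) :
    laplacian δ (m • f) κ = m * laplacian δ f κ := by
  simp only [laplacian, Pi.smul_apply, smul_eq_mul]
  ring

lemma laplacian_add (δ : ℝ) (f g : ℤ → ℝ) (κ : ℤ) :
    laplacian δ (f + g) κ = laplacian δ f κ + laplacian δ g κ := by
  simp only [laplacian, Pi.add_apply]
  ring

lemma memLp_laplacian {μ : Measure ℝ} (h : ∀ κ, MemLp (fun s => w s κ) 2 μ) (κ : ℤ) :
    MemLp (fun s => laplacian δ (w s) κ) 2 μ := by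
  have := (((h (κ + 1)).add (h (κ - 1))).sub ((h κ).const_mul 2)).const_mul (1 / δ ^ 2)
  convert! this using 2 with s
  simp [laplacian]
  ring

lemma intervalIntegrable_of_memLp {f : ℝ → ℝ} (h : MemLp f 2 (volume.restrict (Icc α β)))
    {s t : ℝ} (hs : s ∈ Icc α β) (ht : t ∈ Icc α β) : IntervalIntegrable f volume s t := by
  have h1 : IntegrableOn f (Icc α β) := h.integrable one_le_two
  exact (h1.mono_set (uIcc_subset_Icc hs ht)).intervalIntegrable

lemma IsPath.intervalIntegrable (h : IsPath δ α β ρ w) (κ : ℤ)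
    {s t : ℝ} (hs : s ∈ Icc α β) (ht : t ∈ Icc α β) :
    IntervalIntegrable (fun u => laplacian δ (w u) κ) volume s t :=
  intervalIntegrable_of_memLp (memLp_laplacian h.memL2 κ) hs ht

/-- It suffices to check the integrated equation from a base point. -/
lemma isPath_of_base {b : ℝ} (hb : b ∈ Icc α β)
    (h1 : ∀ s ∈ Icc α β, ρ s ∈ densities δ) (h2 : ∀ s ∈ Icc α β, Memℓp (w s) 2)
    (h3 : ∀ κ, MemLp (fun s => w s κ) 2 (volume.restrict (Icc α β)))
    (h4 : ∀ κ, ∀ t ∈ Icc α β, ρ t κ - ρ b κ = ∫ u in b..t, laplacian δ (w u) κ) :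
    IsPath δ α β ρ w where
  mem_densities := h1
  mem_ell2 := h2
  memL2 := h3
  integral_eq κ s hs t ht := by
    have hi := fun {s t : ℝ} (hs : s ∈ Icc α β) (ht : t ∈ Icc α β) =>
      intervalIntegrable_of_memLp (memLp_laplacian (δ := δ) h3 κ) hs ht
    rw [← intervalIntegral.integral_interval_sub_left (hi hb ht) (hi hb hs), ← h4 κ t ht,
      ← h4 κ s hs]
    ring

lemma absolutelyContinuousOnInterval_congr {f g : ℝ → ℝ} {a b : ℝ}
    (hf : AbsolutelyContinuousOnInterval f a b) (h : EqOn f g (uIcc a b)) :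
    AbsolutelyContinuousOnInterval g a b := by
  refine Tendsto.congr' ?_ hf
  filter_upwards [mem_inf_of_right (mem_principal_self _)] with E hE
  refine Finset.sum_congr rfl fun i hi => ?_
  rw [h (hE.1 i hi).1, h (hE.1 i hi).2]

lemma IsAdmissible.isPath (h : IsAdmissible δ ρ w) : IsPath δ 0 1 ρ w := by
  refine isPath_of_base (b := 0) (by simp) h.mem_densities h.mem_ell2 h.memL2 fun κ t ht => ?_
  have hac := (h.isH1 κ).1.mono (c := 0) (d := t)
    (by rw [uIcc_of_le ht.1, uIcc_of_le zero_le_one]; exact Icc_subset_Icc_right ht.2)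
  rw [← hac.integral_deriv_eq_sub]
  apply intervalIntegral.integral_congr_ae_restrict
  have := h.diffusion_eq κ
  rw [uIoc_of_le ht.1]
  have hsub : Ioc 0 t ⊆ Icc (0 : ℝ) 1 := fun x hx => ⟨hx.1.le, hx.2.trans ht.2⟩
  filter_upwards [ae_restrict_of_ae_restrict_of_subset hsub this] with x hx using hx.deriv

lemma IsPath.isAdmissible (h : IsPath δ 0 1 ρ w) : IsAdmissible δ ρ w := by
  have h0 : (0 : ℝ) ∈ Icc (0 : ℝ) 1 := by simp
  have h1 : (1 : ℝ) ∈ Icc (0 : ℝ) 1 := by simp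
  have hd : ∀ κ, ∀ᵐ s ∂(volume.restrict (Icc (0 : ℝ) 1)),
      HasDerivAt (fun t => ρ t κ) (laplacian δ (w s) κ) s := by
    intro κ
    have hi := (h.intervalIntegrable κ h0 h1).ae_hasDerivAt_integral
    rw [uIcc_of_le zero_le_one] at hi
    -- The derivative is two-sided and nothing is known about `ρ` outside `[0, 1]`, so the endpoints
    -- are discarded.
    rw [← restrict_Ioo_eq_restrict_Icc]
    filter_upwards [ae_restrict_of_ae hi, ae_restrict_mem measurableSet_Ioo] with s hs hs'
    have := (hs (Ioo_subset_Icc_self hs') 0 h0).const_add (ρ 0 κ)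
    refine this.congr_of_eventuallyEq ?_
    filter_upwards [Ioo_mem_nhds hs'.1 hs'.2] with t ht
    rw [← h.integral_eq κ 0 h0 t (Ioo_subset_Icc_self ht)]
    ring
  refine ⟨h.mem_densities, h.mem_ell2, fun κ => ⟨?_, ?_⟩, h.memL2, hd⟩
  · have hac := (h.intervalIntegrable κ h0 h1).absolutelyContinuousOnInterval_intervalIntegral
      (c := 0) (by simp)
    have hc : AbsolutelyContinuousOnInterval (fun _ : ℝ => ρ 0 κ) 0 1 := by
      simp [AbsolutelyContinuousOnInterval, tendsto_const_nhds]
    refine absolutelyContinuousOnInterval_congr (hc.add hac) fun t ht => ?_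
    rw [uIcc_of_le zero_le_one] at ht
    simp only [Pi.add_apply]
    rw [← h.integral_eq κ 0 h0 t ht]
    ring
  · refine (memLp_congr_ae ?_).2 (memLp_laplacian (δ := δ) h.memL2 κ)
    filter_upwards [hd κ] with s hs using hs.deriv

lemma isAdmissible_iff_isPath : IsAdmissible δ ρ w ↔ IsPath δ 0 1 ρ w :=
  ⟨IsAdmissible.isPath, IsPath.isAdmissible⟩

lemma IsPath.mono (h : IsPath δ α β ρ w) {s t : ℝ} (hs : α ≤ s) (ht : t ≤ β) :
    IsPath δ s t ρ w where
  mem_densities u hu := h.mem_densities u (Icc_subset_Icc hs ht hu)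
  mem_ell2 u hu := h.mem_ell2 u (Icc_subset_Icc hs ht hu)
  memL2 κ := (h.memL2 κ).mono_measure (Measure.restrict_mono (Icc_subset_Icc hs ht) le_rfl)
  integral_eq κ u hu v hv :=
    h.integral_eq κ u (Icc_subset_Icc hs ht hu) v (Icc_subset_Icc hs ht hv)

/-- With the junction as base point, every time interval to be checked lies on one side, where a
single piece solves the equation. -/
lemma IsPath.glue {ρ₁ w₁ ρ₂ w₂ : ℝ → ℤ → ℝ} (hαβ : α ≤ β) (hβγ : β ≤ γ)
    (h₁ : IsPath δ α β ρ₁ w₁) (h₂ : IsPath δ β γ ρ₂ w₂) (h : ρ₁ β = ρ₂ β) :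
    IsPath δ α γ ((Iic β).piecewise ρ₁ ρ₂) ((Iic β).piecewise w₁ w₂) := by
  refine isPath_of_base (b := β) ⟨hαβ, hβγ⟩ ?_ ?_ ?_ ?_
  · intro s hs
    by_cases hsβ : s ≤ β
    · rw [piecewise_eq_of_mem _ _ _ (mem_Iic.2 hsβ)]
      exact h₁.mem_densities s ⟨hs.1, hsβ⟩
    · rw [piecewise_eq_of_notMem _ _ _ (by simpa using hsβ)]
      exact h₂.mem_densities s ⟨(not_le.1 hsβ).le, hs.2⟩
  · intro s hs
    by_cases hsβ : s ≤ β
    · rw [piecewise_eq_of_mem _ _ _ (mem_Iic.2 hsβ)]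
      exact h₁.mem_ell2 s ⟨hs.1, hsβ⟩
    · rw [piecewise_eq_of_notMem _ _ _ (by simpa using hsβ)]
      exact h₂.mem_ell2 s ⟨(not_le.1 hsβ).le, hs.2⟩
  · intro κ
    have : (fun s => (Iic β).piecewise w₁ w₂ s κ)
        = (Iic β).piecewise (fun s => w₁ s κ) (fun s => w₂ s κ) := by
      ext s; by_cases hs : s ≤ β <;> simp [piecewise, hs]
    rw [this]
    refine MemLp.piecewise measurableSet_Iic ?_ ?_
    · rw [Measure.restrict_restrict measurableSet_Iic]
      have hsub : Iic β ∩ Icc α γ ⊆ Icc α β := fun x hx => ⟨hx.2.1, hx.1⟩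
      exact (h₁.memL2 κ).mono_measure (Measure.restrict_mono hsub le_rfl)
    · rw [Measure.restrict_restrict measurableSet_Iic.compl]
      have hsub : (Iic β)ᶜ ∩ Icc α γ ⊆ Icc β γ := fun x hx =>
        ⟨(not_le.1 (fun h : x ≤ β => hx.1 h)).le, hx.2.2⟩
      exact (h₂.memL2 κ).mono_measure (Measure.restrict_mono hsub le_rfl)
  · intro κ t ht
    rw [piecewise_eq_of_mem _ _ _ (mem_Iic.2 (le_refl β))]
    by_cases htβ : t ≤ β
    · rw [piecewise_eq_of_mem _ _ _ (mem_Iic.2 htβ),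
        h₁.integral_eq κ β ⟨hαβ, le_rfl⟩ t ⟨ht.1, htβ⟩]
      apply intervalIntegral.integral_congr
      intro u hu
      rw [uIcc_of_ge htβ] at hu
      simp only
      rw [piecewise_eq_of_mem _ _ _ (mem_Iic.2 hu.2)]
    · have htβ' := (not_le.1 htβ).le
      rw [piecewise_eq_of_notMem _ _ _ (by simpa using htβ), h,
        h₂.integral_eq κ β ⟨le_rfl, hβγ⟩ t ⟨htβ', ht.2⟩,
        intervalIntegral.integral_of_le htβ', intervalIntegral.integral_of_le htβ']
      apply setIntegral_congr_fun measurableSet_Ioc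
      intro u hu
      simp only
      rw [piecewise_eq_of_notMem _ _ _ (by simpa using hu.1)]

lemma actionOn_union {s t u : ℝ} (hst : s ≤ t) (htu : t ≤ u) :
    actionOn δ (Icc s u) ρ w = actionOn δ (Icc s t) ρ w + actionOn δ (Icc t u) ρ w := by
  simp only [actionOn]
  rw [← restrict_Ioc_eq_restrict_Icc (a := t), ← Icc_union_Ioc_eq_Icc hst htu,
    lintegral_union measurableSet_Ioc]
  rw [Set.disjoint_left]
  exact fun x hx hx' => absurd hx'.1 (not_lt.2 hx.2)

lemma actionOn_glue {ρ₁ w₁ ρ₂ w₂ : ℝ → ℤ → ℝ} (hαβ : α ≤ β) (hβγ : β ≤ γ) :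
    actionOn δ (Icc α γ) ((Iic β).piecewise ρ₁ ρ₂) ((Iic β).piecewise w₁ w₂)
      = actionOn δ (Icc α β) ρ₁ w₁ + actionOn δ (Icc β γ) ρ₂ w₂ := by
  rw [actionOn_union hαβ hβγ]
  congr 1
  · apply setLIntegral_congr_fun measurableSet_Icc
    intro s hs
    simp only [piecewise_eq_of_mem _ _ _ (mem_Iic.2 hs.2)]
  · simp only [actionOn]
    rw [← restrict_Ioc_eq_restrict_Icc (a := β)]
    apply setLIntegral_congr_fun measurableSet_Ioc
    intro s hs
    have : s ∉ Iic β := by simpa using hs.1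
    simp only [piecewise_eq_of_notMem _ _ _ this]

/-! ### Affine changes of time -/

lemma measurableEmbedding_affine {m : ℝ} (hm : m ≠ 0) (c : ℝ) :
    MeasurableEmbedding fun s : ℝ => m * s + c :=
  (measurableEmbedding_addRight c).comp (measurableEmbedding_mulLeft₀ hm)

lemma map_volume_affine {m : ℝ} (hm : m ≠ 0) (c : ℝ) :
    Measure.map (fun s : ℝ => m * s + c) volume = ENNReal.ofReal |m⁻¹| • volume := by
  have : (fun s : ℝ => m * s + c) = (fun s => s + c) ∘ fun s => m * s := rfl
  rw [this, ← Measure.map_map (by fun_prop) (by fun_prop), Real.map_volume_mul_left hm,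
    Measure.map_smul, map_add_right_eq_self]

lemma map_restrict_affine {m : ℝ} (hm : m ≠ 0) (c : ℝ) {S T : Set ℝ}
    (hST : (fun s : ℝ => m * s + c) ⁻¹' S = T) :
    Measure.map (fun s : ℝ => m * s + c) (volume.restrict T)
      = ENNReal.ofReal |m⁻¹| • volume.restrict S := by
  rw [← hST, ← (measurableEmbedding_affine hm c).restrict_map, map_volume_affine hm,
    Measure.restrict_smul]

/-- By the chain rule `w` picks up the factor `m`. Negative `m` is allowed, to cover time reversal.
-/
lemma IsPath.affine (h : IsPath δ α β ρ w) {m : ℝ} (hm : m ≠ 0) (c : ℝ) {α' β' : ℝ}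
    (hI : (fun s : ℝ => m * s + c) ⁻¹' Icc α β = Icc α' β') :
    IsPath δ α' β' (fun s => ρ (m * s + c)) (fun s => m • w (m * s + c)) := by
  have hmem : ∀ s ∈ Icc α' β', m * s + c ∈ Icc α β := fun s hs => by
    rw [← hI] at hs; exact hs
  refine ⟨fun s hs => h.mem_densities _ (hmem s hs),
    fun s hs => (h.mem_ell2 _ (hmem s hs)).const_smul m, fun κ => ?_, fun κ s hs t ht => ?_⟩
  · simp only [Pi.smul_apply, smul_eq_mul]
    refine MemLp.const_mul ?_ m
    have h1 : MemLp (fun s => w s κ) 2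
        (Measure.map (fun s : ℝ => m * s + c) (volume.restrict (Icc α' β'))) := by
      rw [map_restrict_affine hm c hI]
      exact (h.memL2 κ).smul_measure ENNReal.ofReal_ne_top
    exact (measurableEmbedding_affine hm c).memLp_map_measure_iff.1 h1
  · rw [h.integral_eq κ _ (hmem s hs) _ (hmem t ht)]
    simp only [laplacian_smul, intervalIntegral.integral_const_mul]
    rw [intervalIntegral.integral_comp_mul_add (fun u => laplacian δ (w u) κ) hm c, smul_eq_mul,
      mul_inv_cancel_left₀ hm]

/-- Quadratic homogeneity contributes `m ^ 2`, the change of variables `|m|⁻¹`. -/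
lemma actionOn_affine {m : ℝ} (hm : m ≠ 0) (c : ℝ) {S T : Set ℝ}
    (hST : (fun s : ℝ => m * s + c) ⁻¹' S = T) :
    actionOn δ T (fun s => ρ (m * s + c)) (fun s => m • w (m * s + c))
      = ENNReal.ofReal |m| * actionOn δ S ρ w := by
  simp only [actionOn, Pi.smul_apply, smul_eq_mul, quot_mul_left hm, ENNReal.tsum_mul_left]
  have h1 : ∀ s, ENNReal.ofReal δ * (ENNReal.ofReal (m ^ 2) *
      ∑' κ : ℤ, quot (w (m * s + c) κ) (ρ (m * s + c) κ)) = ENNReal.ofReal (m ^ 2) *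
      (ENNReal.ofReal δ * ∑' κ : ℤ, quot (w (m * s + c) κ) (ρ (m * s + c) κ)) := fun s => by ring
  simp only [h1]
  rw [lintegral_const_mul' _ _ ENNReal.ofReal_ne_top]
  rw [← (measurableEmbedding_affine hm c).lintegral_map
    (fun s => ENNReal.ofReal δ * ∑' κ : ℤ, quot (w s κ) (ρ s κ)), map_restrict_affine hm c hST,
    lintegral_smul_measure, smul_eq_mul, ← mul_assoc, ← ENNReal.ofReal_mul (sq_nonneg _)]
  congr 2
  rw [abs_inv, ← sq_abs]
  field_simp

/-! ### Elementary properties of the distance -/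

lemma diffDist_sq (δ : ℝ) (a b : ℤ → ℝ) :
    diffDist δ a b ^ 2 = ⨅ c ∈ connections δ a b, action δ c := by
  rw [diffDist, ← ENNReal.rpow_natCast, ← ENNReal.rpow_mul]
  norm_num

lemma mem_connections_iff :
    (ρ, w) ∈ connections δ a b ↔ IsPath δ 0 1 ρ w ∧ ρ 0 = a ∧ ρ 1 = b := by
  rw [← isAdmissible_iff_isPath]
  rfl

lemma diffDist_sq_le_of_unit (h : IsPath δ 0 1 ρ w) :
    diffDist δ (ρ 0) (ρ 1) ^ 2 ≤ actionOn δ (Icc 0 1) ρ w := by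
  rw [diffDist_sq]
  exact iInf₂_le (ρ, w) (mem_connections_iff.2 ⟨h, rfl, rfl⟩)

lemma affine_preimage_Icc {m : ℝ} (hm : 0 < m) (c s t : ℝ) :
    (fun u : ℝ => m * u + c) ⁻¹' Icc (m * s + c) (m * t + c) = Icc s t := by
  ext u
  simp [hm]

lemma diffDist_sq_le (hαβ : α < β) (h : IsPath δ α β ρ w) :
    diffDist δ (ρ α) (ρ β) ^ 2 ≤ ENNReal.ofReal (β - α) * actionOn δ (Icc α β) ρ w := by
  have hm : 0 < β - α := sub_pos.2 hαβ
  have hI := affine_preimage_Icc hm α 0 1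
  rw [mul_zero, mul_one, zero_add, sub_add_cancel] at hI
  have := diffDist_sq_le_of_unit (h.affine hm.ne' α hI)
  rwa [actionOn_affine hm.ne' α hI, mul_zero, mul_one, zero_add, sub_add_cancel,
    abs_of_pos hm] at this

/-- A unit-time path of action below `x ^ 2`, stretched to duration `x`, has action at most `x`. In
this normalization the bound is additive under gluing, so no splitting of the time interval has to
be optimized. -/
lemma exists_isPath_of_diffDist_lt {x : ℝ} (hx : 0 < x)
    (h : diffDist δ a b < ENNReal.ofReal x) (t : ℝ) :
    ∃ ρ w, IsPath δ t (t + x) ρ w ∧ ρ t = a ∧ ρ (t + x) = b ∧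
      actionOn δ (Icc t (t + x)) ρ w ≤ ENNReal.ofReal x := by
  have h2 : diffDist δ a b ^ 2 < ENNReal.ofReal (x ^ 2) := by
    rw [ENNReal.ofReal_pow hx.le]
    exact ENNReal.pow_lt_pow_left two_ne_zero h
  rw [diffDist_sq] at h2
  simp only [iInf_lt_iff] at h2
  obtain ⟨⟨ρ, w⟩, hc, hlt⟩ := h2
  obtain ⟨hp, h0, h1⟩ := mem_connections_iff.1 hc
  have hm : 0 < x⁻¹ := inv_pos.2 hx
  have e0 : x⁻¹ * t + -(x⁻¹ * t) = 0 := by ring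
  have e1 : x⁻¹ * (t + x) + -(x⁻¹ * t) = 1 := by field_simp; ring
  have hI := affine_preimage_Icc hm (-(x⁻¹ * t)) t (t + x)
  rw [e0, e1] at hI
  refine ⟨_, _, hp.affine hm.ne' _ hI, by simp only [e0, h0], by simp only [e1, h1], ?_⟩
  rw [actionOn_affine hm.ne' _ hI, abs_of_pos hm]
  calc ENNReal.ofReal x⁻¹ * actionOn δ (Icc 0 1) ρ w
      ≤ ENNReal.ofReal x⁻¹ * ENNReal.ofReal (x ^ 2) := by gcongr; exact hlt.le
    _ = ENNReal.ofReal x := by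
      rw [← ENNReal.ofReal_mul hm.le]; congr 1; field_simp

lemma diffDist_le_of_isPath {x t : ℝ} (hx : 0 < x) (h : IsPath δ t (t + x) ρ w)
    (hA : actionOn δ (Icc t (t + x)) ρ w ≤ ENNReal.ofReal x) :
    diffDist δ (ρ t) (ρ (t + x)) ≤ ENNReal.ofReal x := by
  have h1 := diffDist_sq_le (by linarith) h
  rw [add_sub_cancel_left] at h1
  have h2 : diffDist δ (ρ t) (ρ (t + x)) ^ 2 ≤ ENNReal.ofReal x ^ 2 := by
    rw [sq (ENNReal.ofReal x)]
    exact h1.trans (by gcongr)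
  exact (ENNReal.pow_le_pow_left_iff two_ne_zero).1 h2

lemma ennreal_le_of_forall_ofReal_lt {x y : ℝ≥0∞}
    (h : ∀ r : ℝ, 0 < r → y < ENNReal.ofReal r → x ≤ ENNReal.ofReal r) : x ≤ y := by
  refine le_of_forall_gt_imp_ge_of_dense fun z hz => ?_
  obtain ⟨r, hyr, hrz⟩ := ENNReal.lt_iff_exists_nnreal_btwn.1 hz
  have hr : (0 : ℝ) < r := by
    have := lt_of_le_of_lt (zero_le (a := y)) hyr
    exact_mod_cast this
  have := h r hr (by simpa using hyr)
  simp only [ENNReal.ofReal_coe_nnreal] at this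
  exact this.trans hrz.le

lemma diffDist_triangle (δ : ℝ) (a b c : ℤ → ℝ) :
    diffDist δ a c ≤ diffDist δ a b + diffDist δ b c := by
  rcases eq_or_ne (diffDist δ a b) ⊤ with h | h
  · simp [h]
  rcases eq_or_ne (diffDist δ b c) ⊤ with h' | h'
  · simp [h']
  refine ENNReal.le_of_forall_pos_le_add fun ε hε _ => ?_
  have key : ∀ {u v : ℤ → ℝ}, diffDist δ u v ≠ ⊤ → ∃ x : ℝ, 0 < x ∧
      diffDist δ u v < ENNReal.ofReal x ∧ ENNReal.ofReal x = diffDist δ u v + (ε / 2 : NNReal) := by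
    intro u v hu
    have hε' : (0 : ℝ) < (ε / 2 : NNReal) := by exact_mod_cast half_pos hε
    have e : ENNReal.ofReal ((diffDist δ u v).toReal + (ε / 2 : NNReal))
        = diffDist δ u v + (ε / 2 : NNReal) := by
      rw [ENNReal.ofReal_add ENNReal.toReal_nonneg hε'.le, ENNReal.ofReal_toReal hu,
        ENNReal.ofReal_coe_nnreal]
    refine ⟨(diffDist δ u v).toReal + (ε / 2 : NNReal), by positivity, ?_, e⟩
    rw [e]
    exact ENNReal.lt_add_right hu (by exact_mod_cast hε'.ne')
  obtain ⟨x, hx, hlx, hex⟩ := key h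
  obtain ⟨y, hy, hly, hey⟩ := key h'
  obtain ⟨ρ₁, w₁, hp₁, h₁, h₁', hA₁⟩ := exists_isPath_of_diffDist_lt hx hlx 0
  obtain ⟨ρ₂, w₂, hp₂, h₂, h₂', hA₂⟩ := exists_isPath_of_diffDist_lt hy hly (0 + x)
  have hp := hp₁.glue (by linarith) (by linarith) hp₂ (h₁'.trans h₂.symm)
  have hA := actionOn_glue (δ := δ) (ρ₁ := ρ₁) (w₁ := w₁) (ρ₂ := ρ₂) (w₂ := w₂)
    (by linarith : (0 : ℝ) ≤ 0 + x) (by linarith : 0 + x ≤ 0 + x + y)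
  rw [add_assoc 0 x y] at hp hA h₂' hA₂
  have := diffDist_le_of_isPath (by linarith) hp (by
    rw [hA, ENNReal.ofReal_add hx.le hy.le]
    exact add_le_add hA₁ hA₂)
  rw [piecewise_eq_of_mem _ _ _ (mem_Iic.2 (by linarith)), piecewise_eq_of_notMem _ _ _
    (by simpa using hy), h₁, h₂', ENNReal.ofReal_add hx.le hy.le, hex, hey] at this
  calc _ ≤ _ := this
    _ = diffDist δ a b + diffDist δ b c + ((ε / 2 : NNReal) + (ε / 2 : NNReal) : ℝ≥0∞) := by ring
    _ = _ := by rw [← ENNReal.coe_add, add_halves]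

lemma diffDist_comm_le (δ : ℝ) (a b : ℤ → ℝ) : diffDist δ a b ≤ diffDist δ b a := by
  refine ennreal_le_of_forall_ofReal_lt fun x hx h => ?_
  obtain ⟨ρ, w, hp, h0, h1, hA⟩ := exists_isPath_of_diffDist_lt hx h 0
  rw [zero_add] at hp h1 hA
  have hm : (-1 : ℝ) ≠ 0 := by norm_num
  have hI : (fun s : ℝ => -1 * s + x) ⁻¹' Icc 0 x = Icc 0 x := by
    ext u
    constructor <;> rintro ⟨h, h'⟩ <;> constructor <;> simp at * <;> linarith
  have := diffDist_le_of_isPath (t := 0) hx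
    (by rw [zero_add]; exact hp.affine hm x hI) (by
      rw [zero_add, actionOn_affine hm x hI]
      simpa using hA)
  simpa [h0, h1] using this

lemma diffDist_comm (δ : ℝ) (a b : ℤ → ℝ) : diffDist δ a b = diffDist δ b a :=
  le_antisymm (diffDist_comm_le δ a b) (diffDist_comm_le δ b a)

lemma diffDist_self (ha : a ∈ densities δ) : diffDist δ a a = 0 := by
  have hp : IsPath δ 0 1 (fun _ => a) (fun _ => 0) :=
    ⟨fun _ _ => ha, fun _ _ => zero_memℓp, fun _ => by simp,
      fun κ s _ t _ => by simp [laplacian]⟩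
  have := diffDist_sq_le_of_unit hp
  simpa [actionOn, quot_zero_left (ha.2.1 _)] using this

lemma diffDist_sq_le' (hαβ : α ≤ β) (h : IsPath δ α β ρ w) :
    diffDist δ (ρ α) (ρ β) ^ 2 ≤ ENNReal.ofReal (β - α) * actionOn δ (Icc α β) ρ w := by
  rcases hαβ.eq_or_lt with rfl | hlt
  · simp [diffDist_self (h.mem_densities α ⟨le_rfl, le_rfl⟩)]
  · exact diffDist_sq_le hlt h

/-! ### Estimates along a path of finite action -/

lemma summable_of_mem_densities (ha : a ∈ densities δ) : Summable a := by
  have := ha.1.1.summable (by simp)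
  simp only [ENNReal.toReal_one, Real.rpow_one] at this
  exact this.of_norm

lemma tsum_ofReal_of_mem_densities (hδ : 0 < δ) (ha : a ∈ densities δ) :
    ENNReal.ofReal δ * ∑' κ, ENNReal.ofReal (a κ) = 1 := by
  rw [← ENNReal.ofReal_tsum_of_nonneg ha.2.1 (summable_of_mem_densities ha),
    ← ENNReal.ofReal_mul hδ.le, ha.2.2, ENNReal.ofReal_one]

lemma le_inv_of_mem_densities (hδ : 0 < δ) (ha : a ∈ densities δ) (κ : ℤ) : a κ ≤ δ⁻¹ := by
  have h1 := (summable_of_mem_densities ha).le_tsum κ fun j _ => ha.2.1 j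
  have h2 := ha.2.2
  have : ∑' κ, a κ = δ⁻¹ := by field_simp; linarith
  linarith

lemma two_mul_tsum_enorm_le (hδ : 0 < δ) (ha : a ∈ densities δ) (v : ℤ → ℝ) :
    ENNReal.ofReal (2 * δ) * ∑' κ, ‖v κ‖ₑ ≤ ENNReal.ofReal δ * ∑' κ, quot (v κ) (a κ) + 1 := by
  rw [← tsum_ofReal_of_mem_densities hδ ha, ← mul_add, ← ENNReal.tsum_add, mul_comm 2 δ,
    ENNReal.ofReal_mul hδ.le, mul_assoc, ← ENNReal.tsum_mul_left]
  gcongr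
  rw [ENNReal.ofReal_ofNat]
  exact two_mul_enorm_le_quot_add _ _

lemma tsum_enorm_sq_le (hδ : 0 < δ) (ha : a ∈ densities δ) (v : ℤ → ℝ) :
    ENNReal.ofReal δ ^ 2 * ∑' κ, ‖v κ‖ₑ ^ 2 ≤ ENNReal.ofReal δ * ∑' κ, quot (v κ) (a κ) := by
  rw [sq, mul_assoc, ← ENNReal.tsum_mul_left]
  gcongr with κ
  exact ofReal_mul_enorm_sq_le_quot hδ (le_inv_of_mem_densities hδ ha κ)

lemma IsPath.lintegral_tsum_enorm_le (h : IsPath δ α β ρ w) (hδ : 0 < δ) :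
    ENNReal.ofReal (2 * δ) * ∫⁻ s in Icc α β, ∑' κ, ‖w s κ‖ₑ
      ≤ actionOn δ (Icc α β) ρ w + ENNReal.ofReal (β - α) := by
  rw [← lintegral_const_mul' _ _ ENNReal.ofReal_ne_top]
  calc _ ≤ ∫⁻ s in Icc α β, (ENNReal.ofReal δ * ∑' κ, quot (w s κ) (ρ s κ) + 1) :=
        setLIntegral_mono' measurableSet_Icc fun s hs =>
          two_mul_tsum_enorm_le hδ (h.mem_densities s hs) _
    _ = _ := by
      rw [lintegral_add_right _ measurable_const]
      simp [actionOn]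

lemma IsPath.lintegral_tsum_enorm_sq_le (h : IsPath δ α β ρ w) (hδ : 0 < δ) :
    ENNReal.ofReal δ ^ 2 * ∫⁻ s in Icc α β, ∑' κ, ‖w s κ‖ₑ ^ 2
      ≤ actionOn δ (Icc α β) ρ w := by
  rw [← lintegral_const_mul' _ _ (ENNReal.pow_ne_top ENNReal.ofReal_ne_top)]
  exact setLIntegral_mono' measurableSet_Icc fun s hs => tsum_enorm_sq_le hδ (h.mem_densities s hs) _

/-- Summation by parts; since `φ` has finite support, no decay of `f` is needed. -/
lemma sum_mul_laplacian {φ : ℤ → ℝ} {F : Finset ℤ} (hF : ∀ κ ∉ F, φ κ = 0) (δ : ℝ) (f : ℤ → ℝ) :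
    ∑ κ ∈ F, φ κ * laplacian δ f κ = ∑' κ, laplacian δ φ κ * f κ := by
  have hs : ∀ (m : ℤ) (g : ℤ → ℝ), Summable fun κ => φ (κ + m) * g κ := fun m g => by
    have : Summable fun κ => φ κ * g (κ - m) :=
      summable_of_ne_finset_zero (s := F) fun κ hκ => by simp [hF κ hκ]
    simpa [Function.comp_def] using (Equiv.addRight m).summable_iff.2 this
  have ht : ∀ (m : ℤ) (g : ℤ → ℝ), ∑' κ, φ (κ + m) * g κ = ∑' κ, φ κ * g (κ - m) := fun m g => by
    simpa using (Equiv.addRight m).tsum_eq fun κ => φ κ * g (κ - m)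
  have h0 := ht 0 f
  have h1 := ht 1 f
  have h2 := ht (-1) f
  have s0 := hs 0 f
  have s1 := hs 1 f
  have s2 := hs (-1) f
  have s3 := hs 0 fun κ => f (κ + 1)
  have s4 := hs 0 fun κ => f (κ - 1)
  simp only [add_zero, sub_zero, sub_neg_eq_add, ← sub_eq_add_neg] at *
  have e1 : ∑' κ, laplacian δ φ κ * f κ
      = (∑' κ, φ (κ + 1) * f κ + ∑' κ, φ (κ - 1) * f κ - 2 * ∑' κ, φ κ * f κ) / δ ^ 2 := by
    rw [← s1.tsum_add s2, ← tsum_mul_left, ← (s1.add s2).tsum_sub (s0.mul_left 2), ← tsum_div_const]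
    refine tsum_congr fun κ => ?_
    simp only [laplacian]
    ring
  have e2 : ∑ κ ∈ F, φ κ * laplacian δ f κ
      = (∑' κ, φ κ * f (κ + 1) + ∑' κ, φ κ * f (κ - 1) - 2 * ∑' κ, φ κ * f κ) / δ ^ 2 := by
    rw [← s3.tsum_add s4, ← tsum_mul_left, ← (s3.add s4).tsum_sub (s0.mul_left 2), ← tsum_div_const,
      tsum_eq_sum (s := F) fun κ hκ => by simp [hF κ hκ]]
    refine Finset.sum_congr rfl fun κ _ => ?_
    simp only [laplacian]
    ring
  rw [e1, e2, h1, h2]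
  ring

/-- The weak form of the equation, tested with a finitely supported function. -/
lemma IsPath.abs_sum_mul_sub_le (h : IsPath δ α β ρ w) (hδ : 0 < δ) (hαβ : α ≤ β) {A C : ℝ}
    (hA0 : 0 ≤ A) (hA : actionOn δ (Icc α β) ρ w ≤ ENNReal.ofReal A) {φ : ℤ → ℝ} {F : Finset ℤ}
    (hF : ∀ κ ∉ F, φ κ = 0) (hC : ∀ κ, |laplacian δ φ κ| ≤ C) :
    |∑ κ ∈ F, φ κ * (ρ β κ - ρ α κ)| ≤ C * ((A + (β - α)) / (2 * δ)) := by
  have hC0 : 0 ≤ C := (abs_nonneg _).trans (hC 0)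
  have hα : α ∈ Icc α β := ⟨le_rfl, hαβ⟩
  have hβ : β ∈ Icc α β := ⟨hαβ, le_rfl⟩
  have e1 : ∑ κ ∈ F, φ κ * (ρ β κ - ρ α κ)
      = ∫ u in Ioc α β, ∑ κ ∈ F, φ κ * laplacian δ (w u) κ := by
    rw [← intervalIntegral.integral_of_le hαβ, intervalIntegral.integral_finsetSum
      fun κ _ => (h.intervalIntegrable κ hα hβ).const_mul _]
    refine Finset.sum_congr rfl fun κ _ => ?_
    rw [intervalIntegral.integral_const_mul, h.integral_eq κ α hα β hβ]
  have e2 : ‖∑ κ ∈ F, φ κ * (ρ β κ - ρ α κ)‖ₑ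
      ≤ ENNReal.ofReal C * ∫⁻ s in Icc α β, ∑' κ, ‖w s κ‖ₑ := by
    rw [e1, ← lintegral_const_mul' _ _ ENNReal.ofReal_ne_top]
    refine (enorm_integral_le_lintegral_enorm _).trans
      ((lintegral_mono_set Ioc_subset_Icc_self).trans (lintegral_mono fun s => ?_))
    -- Moving the Laplacian onto `φ` leaves only the `ℓ¹` norm of `w`, with a constant independent
    -- of `F`.
    rw [sum_mul_laplacian hF, ← ENNReal.tsum_mul_left]
    refine enorm_tsum_le_tsum_enorm.trans (ENNReal.tsum_le_tsum fun κ => ?_)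
    rw [enorm_mul]
    gcongr
    rw [Real.enorm_eq_ofReal_abs]
    exact ENNReal.ofReal_le_ofReal (hC κ)
  have e3 : ENNReal.ofReal (2 * δ) * ‖∑ κ ∈ F, φ κ * (ρ β κ - ρ α κ)‖ₑ
      ≤ ENNReal.ofReal (C * (A + (β - α))) := by
    calc _ ≤ ENNReal.ofReal (2 * δ) * (ENNReal.ofReal C * ∫⁻ s in Icc α β, ∑' κ, ‖w s κ‖ₑ) := by
          gcongr
      _ = ENNReal.ofReal C * (ENNReal.ofReal (2 * δ) * ∫⁻ s in Icc α β, ∑' κ, ‖w s κ‖ₑ) := by ring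
      _ ≤ ENNReal.ofReal C * (ENNReal.ofReal A + ENNReal.ofReal (β - α)) := by
          gcongr
          exact (h.lintegral_tsum_enorm_le hδ).trans (by gcongr)
      _ = _ := by
          rw [← ENNReal.ofReal_add hA0 (sub_nonneg.2 hαβ), ← ENNReal.ofReal_mul hC0]
  rw [Real.enorm_eq_ofReal_abs, ← ENNReal.ofReal_mul (by positivity),
    ENNReal.ofReal_le_ofReal_iff (mul_nonneg hC0 (by linarith))] at e3
  rw [← mul_div_assoc, le_div_iff₀ (by positivity)]
  linarith

/-- For every `x > 0` some path has duration `x` and action at most `x`. Tested with a point mass,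
it moves the value at a site by `O(x)`. -/
lemma eq_of_diffDist_eq_zero (hδ : 0 < δ) (h : diffDist δ a b = 0) : a = b := by
  funext κ
  have hC : ∀ j, |laplacian δ (Pi.single κ 1) j| ≤ 4 / δ ^ 2 := by
    intro j
    have h1 : ∀ i, |(Pi.single κ 1 : ℤ → ℝ) i| ≤ 1 := fun i => by
      by_cases hi : i = κ <;> simp [hi]
    simp only [laplacian]
    rw [abs_div, abs_of_pos (by positivity : 0 < δ ^ 2)]
    gcongr
    have := abs_le.1 (h1 (j + 1))
    have := abs_le.1 (h1 (j - 1))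
    have := abs_le.1 (h1 j)
    rw [abs_le]
    constructor <;> linarith
  have key : ∀ x : ℝ, 0 < x → |b κ - a κ| ≤ 4 / δ ^ 2 * ((x + x) / (2 * δ)) := by
    intro x hx
    obtain ⟨ρ, w, hp, h0, h1, hA⟩ :=
      exists_isPath_of_diffDist_lt hx (by rw [h]; simpa using hx) 0
    have := hp.abs_sum_mul_sub_le hδ (by linarith) hx.le hA (φ := Pi.single κ 1) (F := {κ})
      (fun j hj => by simp at hj; simp [hj]) hC
    rw [zero_add] at h1 this
    simpa [h0, h1] using this
  have hlim : Tendsto (fun x : ℝ => 4 / δ ^ 2 * ((x + x) / (2 * δ))) (𝓝[>] 0) (𝓝 0) := by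
    have : Continuous fun x : ℝ => 4 / δ ^ 2 * ((x + x) / (2 * δ)) := by fun_prop
    simpa using (this.tendsto 0).mono_left nhdsWithin_le_nhds
  have := ge_of_tendsto hlim (by filter_upwards [self_mem_nhdsWithin] with x hx using key x hx)
  have := abs_nonpos_iff.1 this
  linarith

/-! ### The second moment -/

/-- A compactly supported truncation of the square, with bounded second differences. -/
def cutSq (R : ℕ) (x : ℝ) : ℝ := max 0 (|x| - x ^ 2 / R) ^ 2

lemma cutSq_nonneg (R : ℕ) (x : ℝ) : 0 ≤ cutSq R x := sq_nonneg _

lemma cutSq_le_sq (R : ℕ) (x : ℝ) : cutSq R x ≤ x ^ 2 := by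
  rw [cutSq, ← sq_abs x]
  gcongr
  refine max_le (abs_nonneg _) ?_
  have : 0 ≤ |x| ^ 2 / R := by positivity
  linarith

lemma cutSq_eq_zero {R : ℕ} (hR : 0 < R) {x : ℝ} (hx : (R : ℝ) ≤ |x|) : cutSq R x = 0 := by
  have hR' : (0 : ℝ) < R := by exact_mod_cast hR
  have : |x| - x ^ 2 / R ≤ 0 := by
    rw [sub_nonpos, le_div_iff₀ hR', ← sq_abs]
    nlinarith [abs_nonneg x]
  simp [cutSq, max_eq_left this]

lemma tendsto_cutSq (x : ℝ) : Tendsto (fun R : ℕ => cutSq R x) atTop (𝓝 (x ^ 2)) := by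
  have h1 : Tendsto (fun R : ℕ => |x| - x ^ 2 / R) atTop (𝓝 (|x| - 0)) :=
    tendsto_const_nhds.sub (tendsto_const_div_atTop_nhds_zero_nat _)
  have h2 := (tendsto_const_nhds (x := (0 : ℝ))).max h1
  simpa [cutSq] using h2.pow 2

/-- The cutoff is the square of `q = max 0 (|x| - x² / R)`. The second difference of `q ^ 2` is the
sum of two squared first differences, each at most `1` as `q` is 1-Lipschitz, and twice `q` times
the second difference of `q`, which contributes at most `1`. The bound does not depend on `R`. -/
lemma abs_cutSq_second_difference_le {R : ℕ} (hR : 0 < R) (k : ℤ) :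
    |cutSq R ((k + 1 : ℤ) : ℝ) + cutSq R ((k - 1 : ℤ) : ℝ) - 2 * cutSq R (k : ℝ)| ≤ 3 := by
  have hR' : (0 : ℝ) < R := by exact_mod_cast hR
  set q : ℝ → ℝ := fun x => max 0 (|x| - x ^ 2 / R) with hq
  have q_in : ∀ x : ℝ, |x| ≤ R → q x = |x| - x ^ 2 / R := fun x hx => by
    apply max_eq_right
    rw [sub_nonneg, div_le_iff₀ hR', ← sq_abs]
    nlinarith [abs_nonneg x]
  have q_out : ∀ x : ℝ, (R : ℝ) ≤ |x| → q x = 0 := fun x hx => by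
    apply max_eq_left
    rw [sub_nonpos, le_div_iff₀ hR', ← sq_abs]
    nlinarith [abs_nonneg x]
  have q0 : ∀ x, 0 ≤ q x := fun x => le_max_left _ _
  have q_le : ∀ x, q x ≤ R / 4 := fun x => by
    refine max_le (by positivity) ?_
    rw [sub_le_iff_le_add, ← sub_le_iff_le_add', le_div_iff₀ hR', ← sq_abs x]
    nlinarith [sq_nonneg (|x| - R / 2)]
  have q_lip : ∀ x y, |y| ≤ |x| → |q x - q y| ≤ |x| - |y| := by
    intro x y hxy
    have hy0 := abs_nonneg y
    rcases le_total |x| R with hx | hx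
    · rw [q_in x hx, q_in y (hxy.trans hx), ← sq_abs x, ← sq_abs y]
      have : |x| - |x| ^ 2 / R - (|y| - |y| ^ 2 / R)
          = (|x| - |y|) * (1 - (|x| + |y|) / R) := by ring
      rw [this, abs_mul, abs_of_nonneg (sub_nonneg.2 hxy)]
      have h1 : 0 ≤ (|x| + |y|) / R := by positivity
      have h2 : (|x| + |y|) / R ≤ 2 := by rw [div_le_iff₀ hR']; linarith
      have : |1 - (|x| + |y|) / R| ≤ 1 := by rw [abs_le]; constructor <;> linarith
      nlinarith
    · rw [q_out x hx]
      rcases le_total |y| R with hy | hy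
      · rw [zero_sub, abs_neg, abs_of_nonneg (q0 y), q_in y hy, ← sq_abs y]
        have : |y| - |y| ^ 2 / R = |y| / R * (R - |y|) := by field_simp
        rw [this]
        have h1 : |y| / R ≤ 1 := by rw [div_le_one hR']; exact hy
        nlinarith
      · rw [q_out y hy]; simpa using hxy
  have q_lip' : ∀ x y, |x - y| ≤ 1 → |q x - q y| ≤ 1 := by
    intro x y hxy
    have h1 := abs_sub_abs_le_abs_sub x y
    have h2 := abs_sub_abs_le_abs_sub y x
    rw [abs_sub_comm y x] at h2
    rcases le_total |y| |x| with h | h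
    · linarith [q_lip x y h]
    · rw [abs_sub_comm]; linarith [q_lip y x h]
  have d1 : |q ((k : ℝ) + 1) - q k| ≤ 1 := q_lip' _ _ (by simp)
  have d2 : |q ((k : ℝ) - 1) - q k| ≤ 1 := q_lip' _ _ (by simp)
  -- The factor `q k` vanishes at the kinks `0` and `±R` and beyond. At other integers, `k - 1`, `k`
  -- and `k + 1` lie on one parabolic branch because `R` is an integer too; there the second
  -- difference is `-2 / R`, and `q ≤ R / 4`.
  have d3 : |q k * (q ((k : ℝ) + 1) + q ((k : ℝ) - 1) - 2 * q k)| ≤ 1 / 2 := by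
    rcases le_total (R : ℝ) |(k : ℝ)| with h | h
    · rw [q_out _ h]; norm_num
    by_cases hk : k = 0
    · simp [hk, hq]
    rcases h.eq_or_lt with h | h
    · rw [q_out _ h.ge]; norm_num
    have hkR : |k| + 1 ≤ (R : ℤ) := by
      have : |k| < (R : ℤ) := by exact_mod_cast h
      linarith
    have hkR' : |(k : ℝ)| + 1 ≤ R := by exact_mod_cast hkR
    have hp : |(k : ℝ) + 1| + |(k : ℝ) - 1| = 2 * |(k : ℝ)| := by
      rcases lt_or_gt_of_ne hk with hk | hk
      · have : (k : ℝ) ≤ -1 := by exact_mod_cast (by omega : k ≤ -1)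
        rw [abs_of_nonpos (by linarith), abs_of_nonpos (by linarith), abs_of_nonpos (by linarith)]
        ring
      · have : (1 : ℝ) ≤ k := by exact_mod_cast hk
        rw [abs_of_nonneg (by linarith), abs_of_nonneg (by linarith), abs_of_nonneg (by linarith)]
        ring
    have hp1 : |(k : ℝ) + 1| ≤ R := (abs_add_le _ _).trans (by simpa using hkR')
    have hp2 : |(k : ℝ) - 1| ≤ R := (abs_sub _ _).trans (by simpa using hkR')
    have : q ((k : ℝ) + 1) + q ((k : ℝ) - 1) - 2 * q k = -2 / R := by
      rw [q_in _ hp1, q_in _ hp2, q_in _ h.le]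
      field_simp
      linear_combination (R : ℝ) * hp
    rw [this, abs_mul, abs_of_nonneg (q0 _), abs_div, abs_of_pos hR']
    norm_num
    rw [← mul_div_assoc, div_le_iff₀ hR']
    linarith [q_le k]
  have e : cutSq R ((k + 1 : ℤ) : ℝ) + cutSq R ((k - 1 : ℤ) : ℝ) - 2 * cutSq R (k : ℝ)
      = (q ((k : ℝ) + 1) - q k) ^ 2 + (q ((k : ℝ) - 1) - q k) ^ 2
        + 2 * (q k * (q ((k : ℝ) + 1) + q ((k : ℝ) - 1) - 2 * q k)) := by
    simp only [cutSq, hq]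
    push_cast
    ring
  rw [e]
  have := (sq_le_one_iff_abs_le_one _).2 d1
  have := (sq_le_one_iff_abs_le_one _).2 d2
  have := abs_le.1 d3
  have := sq_nonneg (q ((k : ℝ) + 1) - q k)
  have := sq_nonneg (q ((k : ℝ) - 1) - q k)
  rw [abs_le]
  constructor <;> linarith

lemma summable_sq_mul_of_mem_densities (hδ : 0 < δ) (ha : a ∈ densities δ) :
    Summable fun κ : ℤ => (κ : ℝ) ^ 2 * a κ := by
  have := ha.1.2.1.mul_left (1 / δ ^ 2)
  refine this.congr fun κ => ?_
  rw [abs_of_nonneg (ha.2.1 κ)]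
  field_simp

/-- Propagation of the second moment. -/
lemma IsPath.sum_sq_mul_le (h : IsPath δ α β ρ w) (hδ : 0 < δ) (hαβ : α ≤ β) {A : ℝ}
    (hA0 : 0 ≤ A) (hA : actionOn δ (Icc α β) ρ w ≤ ENNReal.ofReal A) (F : Finset ℤ) :
    ∑ κ ∈ F, (κ : ℝ) ^ 2 * ρ β κ
      ≤ ∑' κ : ℤ, (κ : ℝ) ^ 2 * ρ α κ + 3 / δ ^ 2 * ((A + (β - α)) / (2 * δ)) := by
  have hα := h.mem_densities α ⟨le_rfl, hαβ⟩
  have hβ := h.mem_densities β ⟨hαβ, le_rfl⟩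
  have hlim : Tendsto (fun R : ℕ => ∑ κ ∈ F, cutSq R κ * ρ β κ) atTop
      (𝓝 (∑ κ ∈ F, (κ : ℝ) ^ 2 * ρ β κ)) :=
    tendsto_finsetSum _ fun κ _ => (tendsto_cutSq _).mul_const _
  refine le_of_tendsto hlim ?_
  filter_upwards [eventually_gt_atTop 0] with R hR
  -- The test needs a finite set containing the support of the cutoff; enlarging `F` only increases
  -- the sum, as its terms are nonnegative.
  set G := F ∪ Finset.Icc (-(R : ℤ)) R with hG
  have hG0 : ∀ κ ∉ G, cutSq R (κ : ℝ) = 0 := by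
    intro κ hκ
    apply cutSq_eq_zero hR
    have : κ ∉ Finset.Icc (-(R : ℤ)) R := fun hh => hκ (Finset.mem_union_right _ hh)
    rw [Finset.mem_Icc, ← abs_le, not_le] at this
    exact_mod_cast this.le
  have hC : ∀ κ, |laplacian δ (fun κ : ℤ => cutSq R (κ : ℝ)) κ| ≤ 3 / δ ^ 2 := by
    intro κ
    simp only [laplacian]
    rw [abs_div, abs_of_pos (by positivity : 0 < δ ^ 2)]
    gcongr
    exact abs_cutSq_second_difference_le hR κ
  have h1 := (abs_le.1 (h.abs_sum_mul_sub_le hδ hαβ hA0 hA hG0 hC)).2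
  simp only [mul_sub, Finset.sum_sub_distrib] at h1
  have h2 : ∑ κ ∈ F, cutSq R κ * ρ β κ ≤ ∑ κ ∈ G, cutSq R κ * ρ β κ :=
    Finset.sum_le_sum_of_subset_of_nonneg Finset.subset_union_left fun κ _ _ =>
      mul_nonneg (cutSq_nonneg _ _) (hβ.2.1 κ)
  have h3 : ∑ κ ∈ G, cutSq R κ * ρ α κ ≤ ∑ κ ∈ G, (κ : ℝ) ^ 2 * ρ α κ :=
    Finset.sum_le_sum fun κ _ => mul_le_mul_of_nonneg_right (cutSq_le_sq _ _) (hα.2.1 κ)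
  have h4 := (summable_sq_mul_of_mem_densities hδ hα).sum_le_tsum G
    fun κ _ => mul_nonneg (sq_nonneg _) (hα.2.1 κ)
  linarith

/-! ### Pointwise limits of densities with bounded second moments -/

/-- Off the window, `|κ| ≥ K + 1 ≥ 1`, so `1 + |κ| ≤ 2 |κ| ≤ 2 κ² / (K + 1)`. -/
lemma abs_mul_le_of_notMem_Icc {h v : ℤ → ℝ} (h0 : ∀ κ, 0 ≤ h κ)
    (hv : ∀ κ : ℤ, |v κ| ≤ 1 + |(κ : ℝ)|) (K : ℕ) {κ : ℤ} (hκ : κ ∉ Finset.Icc (-(K : ℤ)) K) :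
    |v κ * h κ| ≤ 2 / ((K : ℝ) + 1) * ((κ : ℝ) ^ 2 * h κ) := by
  rw [Finset.mem_Icc, ← abs_le, not_le, Int.lt_iff_add_one_le] at hκ
  have hκ' : (K : ℝ) + 1 ≤ |(κ : ℝ)| := by exact_mod_cast hκ
  have hK : (0 : ℝ) < K + 1 := by positivity
  rw [abs_mul, abs_of_nonneg (h0 κ), ← mul_assoc]
  gcongr
  · exact h0 κ
  refine (hv κ).trans ?_
  rw [div_mul_eq_mul_div, le_div_iff₀ hK, ← sq_abs]
  have : (0 : ℝ) ≤ K := K.cast_nonneg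
  nlinarith

lemma summable_mul_of_sq {h v : ℤ → ℝ} (h0 : ∀ κ, 0 ≤ h κ)
    (hv : ∀ κ : ℤ, |v κ| ≤ 1 + |(κ : ℝ)|) (hs : Summable fun κ : ℤ => (κ : ℝ) ^ 2 * h κ) :
    Summable fun κ => v κ * h κ := by
  refine Summable.of_norm_bounded_eventually (hs.mul_left 2) ?_
  filter_upwards [(Finset.finite_toSet (Finset.Icc (-((0 : ℕ) : ℤ)) (0 : ℕ))).compl_mem_cofinite]
    with κ hκ
  simpa using abs_mul_le_of_notMem_Icc h0 hv 0 hκ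

lemma abs_tsum_mul_sub_sum_le {h v : ℤ → ℝ} {M : ℝ} (h0 : ∀ κ, 0 ≤ h κ)
    (hv : ∀ κ : ℤ, |v κ| ≤ 1 + |(κ : ℝ)|)
    (hM : ∀ F : Finset ℤ, ∑ κ ∈ F, (κ : ℝ) ^ 2 * h κ ≤ M) (K : ℕ) :
    |∑' κ, v κ * h κ - ∑ κ ∈ Finset.Icc (-(K : ℤ)) K, v κ * h κ| ≤ 2 / ((K : ℝ) + 1) * M := by
  have hs : Summable fun κ : ℤ => (κ : ℝ) ^ 2 * h κ :=
    summable_of_sum_le (fun κ => mul_nonneg (sq_nonneg _) (h0 κ)) hM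
  have hlim := ((summable_mul_of_sq h0 hv hs).hasSum.sub_const
    (∑ κ ∈ Finset.Icc (-(K : ℤ)) K, v κ * h κ)).abs
  refine le_of_tendsto hlim ?_
  filter_upwards [eventually_ge_atTop (Finset.Icc (-(K : ℤ)) K)] with G hG
  rw [← Finset.sum_sdiff hG, add_sub_cancel_right]
  calc |∑ κ ∈ G \ Finset.Icc (-(K : ℤ)) K, v κ * h κ|
      ≤ ∑ κ ∈ G \ Finset.Icc (-(K : ℤ)) K, |v κ * h κ| := Finset.abs_sum_le_sum_abs _ _
    _ ≤ ∑ κ ∈ G \ Finset.Icc (-(K : ℤ)) K, 2 / ((K : ℝ) + 1) * ((κ : ℝ) ^ 2 * h κ) :=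
        Finset.sum_le_sum fun κ hκ =>
          abs_mul_le_of_notMem_Icc h0 hv K (Finset.mem_sdiff.1 hκ).2
    _ ≤ _ := by
        rw [← Finset.mul_sum]
        gcongr
        exact hM _

/-- The second-moment bound makes the tails uniformly small for weights of at most linear growth,
leaving finite sums. The weights `1` and `κ` give convergence of mass and centre. -/
lemma tendsto_tsum_mul_of_sq_bound {f : ℕ → ℤ → ℝ} {g v : ℤ → ℝ} {M : ℝ}
    (f0 : ∀ n κ, 0 ≤ f n κ) (hv : ∀ κ : ℤ, |v κ| ≤ 1 + |(κ : ℝ)|)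
    (hM : ∀ n, ∀ F : Finset ℤ, ∑ κ ∈ F, (κ : ℝ) ^ 2 * f n κ ≤ M)
    (hlim : ∀ κ, Tendsto (fun n => f n κ) atTop (𝓝 (g κ))) :
    Tendsto (fun n => ∑' κ, v κ * f n κ) atTop (𝓝 (∑' κ, v κ * g κ)) := by
  have g0 : ∀ κ, 0 ≤ g κ := fun κ => ge_of_tendsto' (hlim κ) fun n => f0 n κ
  have gM : ∀ F : Finset ℤ, ∑ κ ∈ F, (κ : ℝ) ^ 2 * g κ ≤ M := fun F =>
    le_of_tendsto' (tendsto_finsetSum F fun κ _ => (hlim κ).const_mul _) fun n => hM n F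
  rw [Metric.tendsto_atTop']
  intro ε hε
  have hK : Tendsto (fun K : ℕ => 2 / ((K : ℝ) + 1) * M) atTop (𝓝 0) := by
    have := (tendsto_one_div_add_atTop_nhds_zero_nat (𝕜 := ℝ)).mul_const (2 * M)
    rw [zero_mul] at this
    exact this.congr fun K => by ring
  obtain ⟨K, hK⟩ := (hK.eventually (gt_mem_nhds (by linarith : 0 < ε / 3))).exists
  have hfin : Tendsto (fun n => ∑ κ ∈ Finset.Icc (-(K : ℤ)) K, v κ * f n κ) atTop
      (𝓝 (∑ κ ∈ Finset.Icc (-(K : ℤ)) K, v κ * g κ)) :=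
    tendsto_finsetSum _ fun κ _ => (hlim κ).const_mul _
  obtain ⟨N, hN⟩ := Metric.tendsto_atTop'.1 hfin (ε / 3) (by linarith)
  refine ⟨N, fun n hn => ?_⟩
  have h1 := hN n hn
  have h2 := abs_tsum_mul_sub_sum_le (f0 n) hv (hM n) K
  have h3 := abs_tsum_mul_sub_sum_le g0 hv gM K
  rw [Real.dist_eq] at h1 ⊢
  have h1' := abs_lt.1 h1
  have h2' := abs_le.1 h2
  have h3' := abs_le.1 h3
  rw [abs_lt]
  constructor <;> linarith

lemma mem_densities_of_tendsto {f : ℕ → ℤ → ℝ} {g : ℤ → ℝ} {M : ℝ}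
    (hf : ∀ n, f n ∈ densities δ)
    (hM : ∀ n, ∀ F : Finset ℤ, ∑ κ ∈ F, (κ : ℝ) ^ 2 * f n κ ≤ M)
    (hlim : ∀ κ, Tendsto (fun n => f n κ) atTop (𝓝 (g κ))) : g ∈ densities δ := by
  have f0 : ∀ n κ, 0 ≤ f n κ := fun n => (hf n).2.1
  have g0 : ∀ κ, 0 ≤ g κ := fun κ => ge_of_tendsto' (hlim κ) fun n => f0 n κ
  have gM : ∀ F : Finset ℤ, ∑ κ ∈ F, (κ : ℝ) ^ 2 * g κ ≤ M := fun F =>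
    le_of_tendsto' (tendsto_finsetSum F fun κ _ => (hlim κ).const_mul _) fun n => hM n F
  have hs : Summable fun κ : ℤ => (κ : ℝ) ^ 2 * g κ :=
    summable_of_sum_le (fun κ => mul_nonneg (sq_nonneg _) (g0 κ)) gM
  have v1 : ∀ κ : ℤ, |(1 : ℝ)| ≤ 1 + |(κ : ℝ)| := fun κ => by simp
  have v2 : ∀ κ : ℤ, |(κ : ℝ)| ≤ 1 + |(κ : ℝ)| := fun κ => by simp
  have t1 := tendsto_tsum_mul_of_sq_bound (v := fun _ => 1) f0 v1 hM hlim
  have t2 := tendsto_tsum_mul_of_sq_bound (v := fun κ => (κ : ℝ)) f0 v2 hM hlim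
  have sg := summable_mul_of_sq (v := fun _ => 1) g0 v1 hs
  simp only [one_mul] at t1 sg
  have e2 : ∀ h : ℤ → ℝ, δ * ∑' κ : ℤ, (δ * κ) * h κ = δ ^ 2 * ∑' κ : ℤ, κ * h κ := fun h => by
    simp only [mul_assoc, tsum_mul_left]
    ring
  refine ⟨⟨?_, ?_, ?_⟩, g0, ?_⟩
  · refine memℓp_gen ?_
    simpa using sg.abs
  · refine (hs.mul_left (δ ^ 2)).congr fun κ => ?_
    rw [abs_of_nonneg (g0 κ)]
    ring
  · rw [e2]
    refine tendsto_nhds_unique (t2.const_mul (δ ^ 2)) (tendsto_const_nhds.congr fun n => ?_)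
    rw [← e2, (hf n).1.2.2]
  · exact tendsto_nhds_unique (t1.const_mul δ) (tendsto_const_nhds.congr fun n => (hf n).2.2.symm)

/-! ### Convexity -/

lemma mid_mem_densities (hδ : 0 < δ) (ha : a ∈ densities δ) (hb : b ∈ densities δ) :
    (1 / 2 : ℝ) • (a + b) ∈ densities δ := by
  have hs := ((summable_of_mem_densities ha).add (summable_of_mem_densities hb)).mul_left (1 / 2)
  have h2 := ((summable_sq_mul_of_mem_densities hδ ha).add
    (summable_sq_mul_of_mem_densities hδ hb)).mul_left (1 / 2)
  have v2 : ∀ κ : ℤ, |(κ : ℝ)| ≤ 1 + |(κ : ℝ)| := fun κ => by simp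
  have sa := summable_mul_of_sq ha.2.1 v2 (summable_sq_mul_of_mem_densities hδ ha)
  have sb := summable_mul_of_sq hb.2.1 v2 (summable_sq_mul_of_mem_densities hδ hb)
  have h0 : ∀ κ, 0 ≤ ((1 / 2 : ℝ) • (a + b)) κ := fun κ => by
    have := ha.2.1 κ
    have := hb.2.1 κ
    simp only [Pi.smul_apply, Pi.add_apply, smul_eq_mul]
    positivity
  have e2 : ∀ h : ℤ → ℝ, δ * ∑' κ : ℤ, (δ * κ) * h κ = δ ^ 2 * ∑' κ : ℤ, κ * h κ := fun h => by
    simp only [mul_assoc, tsum_mul_left]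
    ring
  have ma := ha.1.2.2
  have mb := hb.1.2.2
  rw [e2] at ma mb
  refine ⟨⟨?_, ?_, ?_⟩, h0, ?_⟩
  · exact (ha.1.1.add hb.1.1).const_smul _
  · refine (h2.mul_left (δ ^ 2)).congr fun κ => ?_
    rw [abs_of_nonneg (h0 κ)]
    simp only [Pi.smul_apply, Pi.add_apply, smul_eq_mul]
    ring
  · rw [e2]
    have : ∑' κ : ℤ, (κ : ℝ) * ((1 / 2 : ℝ) • (a + b)) κ
        = 1 / 2 * (∑' κ : ℤ, (κ : ℝ) * a κ + ∑' κ : ℤ, (κ : ℝ) * b κ) := by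
      rw [← sa.tsum_add sb, ← tsum_mul_left]
      refine tsum_congr fun κ => ?_
      simp only [Pi.smul_apply, Pi.add_apply, smul_eq_mul]
      ring
    rw [this]
    linarith
  · have : ∑' κ : ℤ, ((1 / 2 : ℝ) • (a + b)) κ = 1 / 2 * (∑' κ : ℤ, a κ + ∑' κ : ℤ, b κ) := by
      rw [← (summable_of_mem_densities ha).tsum_add (summable_of_mem_densities hb),
        ← tsum_mul_left]
      rfl
    rw [this]
    linarith [ha.2.2, hb.2.2]

lemma IsPath.mid {ρ₁ w₁ ρ₂ w₂ : ℝ → ℤ → ℝ} (hδ : 0 < δ)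
    (h₁ : IsPath δ α β ρ₁ w₁) (h₂ : IsPath δ α β ρ₂ w₂) :
    IsPath δ α β (fun s => (1 / 2 : ℝ) • (ρ₁ s + ρ₂ s)) (fun s => (1 / 2 : ℝ) • (w₁ s + w₂ s)) where
  mem_densities s hs := mid_mem_densities hδ (h₁.mem_densities s hs) (h₂.mem_densities s hs)
  mem_ell2 s hs := ((h₁.mem_ell2 s hs).add (h₂.mem_ell2 s hs)).const_smul _
  memL2 κ := ((h₁.memL2 κ).add (h₂.memL2 κ)).const_mul (1 / 2 : ℝ)
  integral_eq κ s hs t ht := by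
    simp only [laplacian_smul, laplacian_add]
    rw [intervalIntegral.integral_const_mul, intervalIntegral.integral_add
      (h₁.intervalIntegrable κ hs ht) (h₂.intervalIntegrable κ hs ht),
      ← h₁.integral_eq κ s hs t ht, ← h₂.integral_eq κ s hs t ht]
    simp only [Pi.smul_apply, Pi.add_apply, smul_eq_mul]
    ring

lemma IsPath.aemeasurable_quot (h : IsPath δ 0 1 ρ w) (κ : ℤ) :
    AEMeasurable (fun s => quot (w s κ) (ρ s κ)) (volume.restrict (Icc 0 1)) := by
  have hρ : ContinuousOn (fun s => ρ s κ) (Icc 0 1) := by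
    simpa using (h.isAdmissible.isH1 κ).1.continuousOn
  exact measurable_quot.comp_aemeasurable
    ((h.memL2 κ).1.aemeasurable.prodMk (hρ.aemeasurable measurableSet_Icc))

lemma IsPath.aemeasurable_action (h : IsPath δ 0 1 ρ w) :
    AEMeasurable (fun s => ENNReal.ofReal δ * ∑' κ : ℤ, quot (w s κ) (ρ s κ))
      (volume.restrict (Icc 0 1)) :=
  (AEMeasurable.tsum h.aemeasurable_quot).const_mul _

lemma actionOn_mid_le {ρ₁ w₁ ρ₂ w₂ : ℝ → ℤ → ℝ} (h₁ : IsPath δ 0 1 ρ₁ w₁) {B : ℝ≥0∞}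
    (hB₁ : actionOn δ (Icc 0 1) ρ₁ w₁ ≤ B) (hB₂ : actionOn δ (Icc 0 1) ρ₂ w₂ ≤ B) :
    actionOn δ (Icc 0 1) (fun s => (1 / 2 : ℝ) • (ρ₁ s + ρ₂ s))
      (fun s => (1 / 2 : ℝ) • (w₁ s + w₂ s)) ≤ B := by
  have e : ∀ x y : ℝ, (1 / 2 : ℝ) * (x + y) = (x + y) / 2 := fun x y => by ring
  calc _ ≤ ∫⁻ s in Icc (0 : ℝ) 1, 2⁻¹ * ((ENNReal.ofReal δ * ∑' κ : ℤ, quot (w₁ s κ) (ρ₁ s κ))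
          + (ENNReal.ofReal δ * ∑' κ : ℤ, quot (w₂ s κ) (ρ₂ s κ))) := by
        refine lintegral_mono fun s => ?_
        rw [← mul_add, ← ENNReal.tsum_add, mul_left_comm, ← ENNReal.tsum_mul_left (a := 2⁻¹)]
        gcongr with κ
        simp only [Pi.smul_apply, Pi.add_apply, smul_eq_mul, e]
        refine (quot_mid_le _ _ _ _).trans (le_of_eq ?_)
        rw [ENNReal.div_eq_inv_mul]
    _ = 2⁻¹ * (actionOn δ (Icc 0 1) ρ₁ w₁ + actionOn δ (Icc 0 1) ρ₂ w₂) := by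
        rw [lintegral_const_mul' _ _ (by simp), lintegral_add_left' h₁.aemeasurable_action]
        rfl
    _ ≤ 2⁻¹ * (B + B) := by gcongr
    _ = B := by
        rw [← two_mul, ← mul_assoc, ENNReal.inv_mul_cancel two_ne_zero (by simp), one_mul]

/-! ### Square integrable functions on space-time -/

/-- The product of Lebesgue measure on `[0, 1]` and counting measure on the lattice. -/
abbrev spaceTime : Measure (ℝ × ℤ) := (volume.restrict (Icc 0 1)).prod Measure.count

instance isProbabilityMeasure_unitInterval :
    IsProbabilityMeasure (volume.restrict (Icc (0 : ℝ) 1)) := ⟨by simp⟩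

/-- Counting measure dominates the Dirac mass at `κ`; hence space-time norms control every single
component. -/
lemma map_slice_le (κ : ℤ) :
    Measure.map (fun s : ℝ => (s, κ)) (volume.restrict (Icc 0 1)) ≤ spaceTime := by
  rw [← Measure.prod_dirac]
  exact Measure.prod_mono le_rfl (Measure.le_sum _ κ)

lemma memLp_slice {f : ℝ × ℤ → ℝ} (hf : MemLp f 2 spaceTime) (κ : ℤ) :
    MemLp (fun s => f (s, κ)) 2 (volume.restrict (Icc 0 1)) :=
  (hf.mono_measure (map_slice_le κ)).comp_of_map (by fun_prop)

lemma eLpNorm_slice_le {f : ℝ × ℤ → ℝ} (hf : AEStronglyMeasurable f spaceTime) (κ : ℤ) :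
    eLpNorm (fun s => f (s, κ)) 2 (volume.restrict (Icc 0 1)) ≤ eLpNorm f 2 spaceTime := by
  have := eLpNorm_map_measure (p := 2) (hf.mono_measure (map_slice_le κ))
    (by fun_prop : AEMeasurable (fun s : ℝ => (s, κ)) (volume.restrict (Icc 0 1)))
  exact this.symm.le.trans (eLpNorm_mono_measure _ (map_slice_le κ))

lemma ae_forall_of_ae_spaceTime {p : ℝ × ℤ → Prop} (h : ∀ᵐ z ∂spaceTime, p z) :
    ∀ᵐ s ∂(volume.restrict (Icc (0 : ℝ) 1)), ∀ κ : ℤ, p (s, κ) := by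
  filter_upwards [Measure.ae_ae_of_ae_prod h] with s hs
  exact Measure.ae_count_iff.1 hs

lemma aestronglyMeasurable_spaceTime
    (h : ∀ κ, AEStronglyMeasurable (fun s => w s κ) (volume.restrict (Icc 0 1))) :
    AEStronglyMeasurable (fun z : ℝ × ℤ => w z.1 z.2) spaceTime := by
  refine ⟨fun z => (h z.2).mk _ z.1, ?_, ?_⟩
  · exact (measurable_from_prod_countable_left fun κ =>
      (h κ).stronglyMeasurable_mk.measurable).stronglyMeasurable
  · have : ∀ᵐ s ∂(volume.restrict (Icc (0 : ℝ) 1)), ∀ κ, w s κ = (h κ).mk _ s :=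
      ae_all_iff.2 fun κ => (h κ).ae_eq_mk
    filter_upwards [Measure.quasiMeasurePreserving_fst.ae this] with z hz using hz z.2

lemma eLpNorm_spaceTime_sq {f : ℝ × ℤ → ℝ} (hf : AEStronglyMeasurable f spaceTime) :
    eLpNorm f 2 spaceTime ^ 2 = ∫⁻ s in Icc (0 : ℝ) 1, ∑' κ, ‖f (s, κ)‖ₑ ^ 2 := by
  have h := eLpNorm_nnreal_pow_eq_lintegral (f := f) (μ := spaceTime) (p := 2) two_ne_zero
  simp only [NNReal.coe_ofNat, ENNReal.rpow_ofNat, ENNReal.coe_ofNat] at h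
  rw [h, lintegral_prod _ (hf.enorm.pow_const 2)]
  simp only [lintegral_count]

lemma IsPath.eLpNorm_sq_le (h : IsPath δ 0 1 ρ w) (hδ : 0 < δ) :
    ENNReal.ofReal δ ^ 2 * eLpNorm (fun z : ℝ × ℤ => w z.1 z.2) 2 spaceTime ^ 2
      ≤ actionOn δ (Icc 0 1) ρ w := by
  rw [eLpNorm_spaceTime_sq (aestronglyMeasurable_spaceTime fun κ => (h.memL2 κ).1)]
  exact h.lintegral_tsum_enorm_sq_le hδ

lemma IsPath.eLpNorm_le (h : IsPath δ 0 1 ρ w) (hδ : 0 < δ) {A : ℝ} (hA0 : 0 ≤ A)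
    (hA : actionOn δ (Icc 0 1) ρ w ≤ ENNReal.ofReal A) :
    eLpNorm (fun z : ℝ × ℤ => w z.1 z.2) 2 spaceTime ≤ ENNReal.ofReal (√A / δ) := by
  have h1 := (h.eLpNorm_sq_le hδ).trans hA
  rw [← mul_pow, ← Real.sq_sqrt hA0, ENNReal.ofReal_pow (Real.sqrt_nonneg A),
    ENNReal.pow_le_pow_left_iff two_ne_zero] at h1
  rw [ENNReal.ofReal_div_of_pos hδ, ENNReal.le_div_iff_mul_le (by simp [hδ]) (by simp), mul_comm]
  exact h1

lemma IsPath.memLp_spaceTime (h : IsPath δ 0 1 ρ w) (hδ : 0 < δ) {A : ℝ} (hA0 : 0 ≤ A)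
    (hA : actionOn δ (Icc 0 1) ρ w ≤ ENNReal.ofReal A) :
    MemLp (fun z : ℝ × ℤ => w z.1 z.2) 2 spaceTime :=
  ⟨aestronglyMeasurable_spaceTime fun κ => (h.memL2 κ).1,
    (h.eLpNorm_le hδ hA0 hA).trans_lt ENNReal.ofReal_lt_top⟩

lemma ae_memℓp_of_memLp {f : ℝ × ℤ → ℝ} (hf : MemLp f 2 spaceTime) :
    ∀ᵐ s ∂(volume.restrict (Icc (0 : ℝ) 1)), Memℓp (fun κ => f (s, κ)) 2 := by
  have h1 : ∫⁻ s in Icc (0 : ℝ) 1, ∑' κ, ‖f (s, κ)‖ₑ ^ 2 ≠ ⊤ := by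
    rw [← eLpNorm_spaceTime_sq hf.1]
    exact ENNReal.pow_ne_top hf.2.ne
  have h2 : AEMeasurable (fun s => ∑' κ, ‖f (s, κ)‖ₑ ^ 2) (volume.restrict (Icc (0 : ℝ) 1)) :=
    AEMeasurable.tsum fun κ => (memLp_slice hf κ).1.enorm.pow_const 2
  filter_upwards [ae_lt_top' h2 h1] with s hs
  refine memℓp_gen ?_
  have h3 := ENNReal.summable_toReal hs.ne
  simpa using h3

lemma integral_laplacian {t : ℝ} (ht : t ∈ Icc (0 : ℝ) 1)
    (h : ∀ κ, MemLp (fun s => w s κ) 2 (volume.restrict (Icc 0 1))) (κ : ℤ) :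
    ∫ u in 0..t, laplacian δ (w u) κ
      = laplacian δ (fun κ => ∫ u in 0..t, w u κ) κ := by
  have hi := fun κ => intervalIntegrable_of_memLp (h κ) (left_mem_Icc.2 zero_le_one) ht
  simp only [laplacian]
  rw [intervalIntegral.integral_div, intervalIntegral.integral_sub
    ((hi _).add (hi _)) ((hi _).const_mul _), intervalIntegral.integral_add (hi _) (hi _),
    intervalIntegral.integral_const_mul]

lemma tendsto_integral_slice {f : ℕ → ℝ × ℤ → ℝ} {g : ℝ × ℤ → ℝ}
    (hf : ∀ n, MemLp (f n) 2 spaceTime) (hg : MemLp g 2 spaceTime)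
    (h : Tendsto (fun n => eLpNorm (f n - g) 2 spaceTime) atTop (𝓝 0)) (κ : ℤ) {t : ℝ}
    (ht : t ∈ Icc (0 : ℝ) 1) :
    Tendsto (fun n => ∫ u in 0..t, f n (u, κ)) atTop (𝓝 (∫ u in 0..t, g (u, κ))) := by
  have h1 : Tendsto (fun n => eLpNorm ((fun s => f n (s, κ)) - fun s => g (s, κ)) 1
      (volume.restrict (Icc (0 : ℝ) 1))) atTop (𝓝 0) := by
    refine tendsto_of_tendsto_of_tendsto_of_le_of_le tendsto_const_nhds h (fun _ => zero_le)
      fun n => ?_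
    exact (eLpNorm_le_eLpNorm_of_exponent_le one_le_two
      ((memLp_slice (hf n) κ).sub (memLp_slice hg κ)).1).trans
      (eLpNorm_slice_le ((hf n).sub hg).1 κ)
  have h2 := tendsto_setIntegral_of_L1' _ (memLp_slice hg κ).1
    (Eventually.of_forall fun n => (memLp_slice (hf n) κ).integrable one_le_two) h1 (Ioc 0 t)
  have hsub : Ioc 0 t ∩ Icc 0 1 = Ioc 0 t :=
    inter_eq_left.2 fun x hx => ⟨hx.1.le, hx.2.trans ht.2⟩
  simpa only [intervalIntegral.integral_of_le ht.1, Measure.restrict_restrict measurableSet_Ioc,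
    hsub] using h2

lemma tsum_quot_le_liminf {v r : ℕ → ℤ → ℝ} {v₀ r₀ : ℤ → ℝ}
    (hv : ∀ κ, Tendsto (fun n => v n κ) atTop (𝓝 (v₀ κ)))
    (hr : ∀ κ, Tendsto (fun n => r n κ) atTop (𝓝 (r₀ κ))) :
    ∑' κ, quot (v₀ κ) (r₀ κ) ≤ liminf (fun n => ∑' κ, quot (v n κ) (r n κ)) atTop := by
  simp only [← lintegral_count]
  exact (lintegral_mono fun κ => quot_le_liminf (hv κ) (hr κ)).trans
    (lintegral_liminf_le fun n => measurable_of_countable _)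

/-- Fatou twice, over the lattice and over time, on top of the lower semicontinuity of `quot`. -/
lemma actionOn_le_liminf {ρs ws : ℕ → ℝ → ℤ → ℝ} (hp : ∀ n, IsPath δ 0 1 (ρs n) (ws n))
    (hw : ∀ᵐ s ∂(volume.restrict (Icc (0 : ℝ) 1)), ∀ κ,
      Tendsto (fun n => ws n s κ) atTop (𝓝 (w s κ)))
    (hρ : ∀ s ∈ Icc (0 : ℝ) 1, ∀ κ, Tendsto (fun n => ρs n s κ) atTop (𝓝 (ρ s κ))) :
    actionOn δ (Icc 0 1) ρ w ≤ liminf (fun n => actionOn δ (Icc 0 1) (ρs n) (ws n)) atTop := by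
  refine le_trans (lintegral_mono_ae ?_) (lintegral_liminf_le' fun n => (hp n).aemeasurable_action)
  filter_upwards [hw, ae_restrict_mem measurableSet_Icc] with s hs hs'
  rw [ENNReal.liminf_const_mul_of_ne_top ENNReal.ofReal_ne_top]
  gcongr
  exact tsum_quot_le_liminf hs (hρ s hs')

/-! ### Existence of minimizers -/

/-- A sequence of paths with common starting point and bounded action, whose second components
converge in the mean, converges to a path. -/
lemma exists_limit_path (hδ : 0 < δ) {ρs ws : ℕ → ℝ → ℤ → ℝ} {A : ℝ} (hA0 : 0 ≤ A)
    (hp : ∀ n, IsPath δ 0 1 (ρs n) (ws n)) (ha : ∀ n, ρs n 0 = a)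
    (hA : ∀ n, actionOn δ (Icc 0 1) (ρs n) (ws n) ≤ ENNReal.ofReal A) {g : ℝ × ℤ → ℝ}
    (hg : MemLp g 2 spaceTime)
    (hlim : Tendsto (fun n => eLpNorm ((fun z => ws n z.1 z.2) - g) 2 spaceTime) atTop (𝓝 0)) :
    ∃ ρ w, IsPath δ 0 1 ρ w ∧
      (∀ᵐ s ∂(volume.restrict (Icc (0 : ℝ) 1)), ∀ κ, w s κ = g (s, κ)) ∧
      ∀ s ∈ Icc (0 : ℝ) 1, ∀ κ, Tendsto (fun n => ρs n s κ) atTop (𝓝 (ρ s κ)) := by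
  classical
  have h0 : (0 : ℝ) ∈ Icc (0 : ℝ) 1 := by simp
  -- The limit is in `ℓ²` only at almost every time, but a path needs this at all times; it is reset
  -- to `0` on the exceptional null set.
  set w : ℝ → ℤ → ℝ := fun s => if Memℓp (fun κ => g (s, κ)) 2 then fun κ => g (s, κ) else 0
    with hw
  have hwg : ∀ᵐ s ∂(volume.restrict (Icc (0 : ℝ) 1)), ∀ κ, w s κ = g (s, κ) := by
    filter_upwards [ae_memℓp_of_memLp hg] with s hs κ
    simp only [hw, if_pos hs]
  have hwL : ∀ κ, MemLp (fun s => w s κ) 2 (volume.restrict (Icc 0 1)) := fun κ => by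
    refine (memLp_congr_ae ?_).2 (memLp_slice hg κ)
    filter_upwards [hwg] with s hs using hs κ
  -- Integrating from `a` makes the equation automatic; what remains is that `ρ s` is a density, as
  -- the pointwise limit of the `ρs n s`.
  set ρ : ℝ → ℤ → ℝ := fun s κ => a κ + ∫ u in 0..s, laplacian δ (w u) κ with hρ
  have hws := fun n => (hp n).memLp_spaceTime hδ hA0 (hA n)
  have hconv : ∀ s ∈ Icc (0 : ℝ) 1, ∀ κ, Tendsto (fun n => ρs n s κ) atTop (𝓝 (ρ s κ)) := by
    intro s hs κ
    have hint : ∀ κ, Tendsto (fun n => ∫ u in 0..s, ws n u κ) atTop (𝓝 (∫ u in 0..s, w u κ)) := by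
      intro κ
      have := tendsto_integral_slice hws hg hlim κ hs
      have e : ∫ u in 0..s, w u κ = ∫ u in 0..s, g (u, κ) := by
        apply intervalIntegral.integral_congr_ae_restrict
        rw [uIoc_of_le hs.1]
        have hsub : Ioc 0 s ⊆ Icc (0 : ℝ) 1 := fun x hx => ⟨hx.1.le, hx.2.trans hs.2⟩
        filter_upwards [ae_restrict_of_ae_restrict_of_subset hsub hwg] with u hu using hu κ
      rwa [e]
    have e : ∀ n, ρs n s κ = a κ + laplacian δ (fun κ => ∫ u in 0..s, ws n u κ) κ := fun n => by
      rw [← integral_laplacian hs (hp n).memL2, ← (hp n).integral_eq κ 0 h0 s hs, ha n]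
      ring
    have e' : ρ s κ = a κ + laplacian δ (fun κ => ∫ u in 0..s, w u κ) κ := by
      rw [← integral_laplacian hs hwL]
    simp only [e, e', laplacian]
    exact ((((hint _).add (hint _)).sub ((hint _).const_mul 2)).div_const _).const_add _
  refine ⟨ρ, w, isPath_of_base h0 (fun s hs => ?_) (fun s _ => ?_) hwL (fun κ t _ => ?_), hwg,
    hconv⟩
  · refine mem_densities_of_tendsto
      (M := ∑' κ : ℤ, (κ : ℝ) ^ 2 * a κ + 3 / δ ^ 2 * ((A + (s - 0)) / (2 * δ)))
      (fun n => (hp n).mem_densities s hs) (fun n F => ?_) (hconv s hs)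
    have hA' : actionOn δ (Icc 0 s) (ρs n) (ws n) ≤ ENNReal.ofReal A :=
      (lintegral_mono_set (Icc_subset_Icc_right hs.2)).trans (hA n)
    have := ((hp n).mono le_rfl hs.2).sum_sq_mul_le hδ hs.1 hA0 hA' F
    rwa [ha n] at this
  · simp only [hw]
    split_ifs with h
    · exact h
    · exact zero_memℓp
  · simp [hρ]

lemma exists_minimizer (hδ : 0 < δ) (h : diffDist δ a b ≠ ⊤) :
    ∃ ρ w, IsPath δ 0 1 ρ w ∧ ρ 0 = a ∧ ρ 1 = b ∧
      actionOn δ (Icc 0 1) ρ w = diffDist δ a b ^ 2 := by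
  set I := diffDist δ a b ^ 2 with hI
  have hItop : I ≠ ⊤ := ENNReal.pow_ne_top h
  set ε : ℕ → ℝ≥0∞ := fun n => ENNReal.ofReal (1 / ((n : ℝ) + 1)) with hε
  have hε_anti : Antitone ε := fun m n hmn =>
    ENNReal.ofReal_le_ofReal (one_div_le_one_div_of_le (by positivity) (by gcongr))
  have hε0 : ε 0 = 1 := by simp [hε]
  have hε_lim : Tendsto ε atTop (𝓝 0) := by
    have := ENNReal.tendsto_ofReal (tendsto_one_div_add_atTop_nhds_zero_nat (𝕜 := ℝ))
    rwa [ENNReal.ofReal_zero] at this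
  set A : ℝ := (I + 1).toReal with hAdef
  have hA : I + 1 = ENNReal.ofReal A := (ENNReal.ofReal_toReal (by simp [hItop])).symm
  have hA0 : 0 ≤ A := ENNReal.toReal_nonneg
  have hbound : ∀ n, I + ε n ≤ ENNReal.ofReal A := fun n => by
    rw [← hA, ← hε0]
    gcongr
    exact hε_anti (Nat.zero_le n)
  -- Only the `w`-components of paths within `ε n` of the infimum are recorded. The limit need not
  -- belong to these sets, so they need not be closed.
  set K : ℕ → Set (Lp ℝ 2 spaceTime) := fun n =>
    {x | ∃ ρ w, IsPath δ 0 1 ρ w ∧ ρ 0 = a ∧ ρ 1 = b ∧ actionOn δ (Icc 0 1) ρ w ≤ I + ε n ∧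
      x =ᵐ[spaceTime] fun z => w z.1 z.2} with hK
  have hne : ∀ n, (K n).Nonempty := by
    intro n
    have hlt : I < I + ε n := ENNReal.lt_add_right hItop (by simp [hε]; positivity)
    have hlt' := (diffDist_sq δ a b).symm.trans_lt hlt
    obtain ⟨⟨ρ, w⟩, hc, hlt⟩ : ∃ c, ∃ _ : c ∈ connections δ a b, action δ c < I + ε n := by
      simpa only [iInf_lt_iff] using hlt'
    obtain ⟨hp, h0, h1⟩ := mem_connections_iff.1 hc
    have hact : actionOn δ (Icc 0 1) ρ w ≤ I + ε n := hlt.le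
    exact ⟨(hp.memLp_spaceTime hδ hA0 (hact.trans (hbound n))).toLp, ρ, w, hp, h0, h1, hact,
      MemLp.coeFn_toLp _⟩
  have hanti : Antitone K := fun m n hmn x hx => by
    obtain ⟨ρ, w, hp, h0, h1, hact, hx⟩ := hx
    exact ⟨ρ, w, hp, h0, h1, hact.trans (by gcongr; exact hε_anti hmn), hx⟩
  have hbdd : ∀ x ∈ K 0, ‖x‖ ≤ √A / δ := by
    rintro x ⟨ρ, w, hp, h0, h1, hact, hx⟩
    rw [Lp.norm_def, eLpNorm_congr_ae hx]
    exact ENNReal.toReal_le_of_le_ofReal (by positivity)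
      (hp.eLpNorm_le hδ hA0 (hact.trans (hbound 0)))
  have hmid : ∀ n, ∀ x ∈ K n, ∀ y ∈ K n, (1 / 2 : ℝ) • (x + y) ∈ K n := by
    rintro n x ⟨ρ₁, w₁, hp₁, h₁, h₁', hA₁, hx⟩ y ⟨ρ₂, w₂, hp₂, h₂, h₂', hA₂, hy⟩
    refine ⟨_, _, hp₁.mid hδ hp₂, ?_, ?_, actionOn_mid_le hp₁ hA₁ hA₂, ?_⟩
    · rw [h₁, h₂, ← two_smul ℝ a, smul_smul]
      norm_num
    · rw [h₁', h₂', ← two_smul ℝ b, smul_smul]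
      norm_num
    · filter_upwards [Lp.coeFn_smul (1 / 2 : ℝ) (x + y), Lp.coeFn_add x y, hx, hy]
        with z h1 h2 h3 h4
      simp only [h1, Pi.smul_apply, h2, Pi.add_apply, h3, h4]
  obtain ⟨x, hxK, hxC⟩ := exists_cauchySeq_of_midpoint K hne hanti _ hbdd hmid
  obtain ⟨g, hxg⟩ := cauchySeq_tendsto_of_complete hxC
  choose ρs ws hp ha hb hact hxw using hxK
  have hlim : Tendsto (fun n => eLpNorm ((fun z : ℝ × ℤ => ws n z.1 z.2) - (g : ℝ × ℤ → ℝ)) 2 spaceTime)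
      atTop (𝓝 0) := by
    refine ((Lp.tendsto_Lp_iff_tendsto_eLpNorm' x g).1 hxg).congr fun n => ?_
    exact eLpNorm_congr_ae ((hxw n).sub (ae_eq_refl _))
  obtain ⟨ρ, w, hpath, hwg, hρ⟩ := exists_limit_path hδ hA0 hp ha
    (fun n => (hact n).trans (hbound n)) (Lp.memLp g) hlim
  have hρ0 : ρ 0 = a := funext fun κ =>
    tendsto_nhds_unique (hρ 0 (by simp) κ) (by simp [ha])
  have hρ1 : ρ 1 = b := funext fun κ =>
    tendsto_nhds_unique (hρ 1 (by simp) κ) (by simp [hb])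
  refine ⟨ρ, w, hpath, hρ0, hρ1, le_antisymm ?_ ?_⟩
  -- Fatou needs pointwise convergence of `w`, available almost everywhere along a subsequence.
  · obtain ⟨ns, hns, hae⟩ := (tendstoInMeasure_of_tendsto_Lp hxg).exists_seq_tendsto_ae
    have hw : ∀ᵐ s ∂(volume.restrict (Icc (0 : ℝ) 1)), ∀ κ,
        Tendsto (fun i => ws (ns i) s κ) atTop (𝓝 (w s κ)) := by
      filter_upwards [hwg, ae_forall_of_ae_spaceTime hae,
        ae_forall_of_ae_spaceTime (ae_all_iff.2 hxw)] with s h1 h2 h3 κ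
      rw [h1 κ]
      exact (h2 κ).congr fun i => h3 κ (ns i)
    have hfatou := actionOn_le_liminf (fun i => hp (ns i)) hw
      fun s hs κ => (hρ s hs κ).comp hns.tendsto_atTop
    have hlimI : Tendsto (fun i => I + ε (ns i)) atTop (𝓝 (I + 0)) :=
      (hε_lim.comp hns.tendsto_atTop).const_add I
    rw [add_zero] at hlimI
    calc _ ≤ _ := hfatou
      _ ≤ liminf (fun i => I + ε (ns i)) atTop :=
        liminf_le_liminf (Eventually.of_forall fun i => hact (ns i))
      _ = I := hlimI.liminf_eq
  · rw [hI, ← hρ0, ← hρ1]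
    exact diffDist_sq_le_of_unit hpath

/-! ### Minimizers are geodesics -/

/-- Equality case of the Cauchy-Schwarz inequality, for a partition of `[0, 1]` in three pieces. -/
lemma eq_mul_of_sq_le_mul {x y z A B C l m n D : ℝ} (hl : 0 ≤ l) (hm : 0 ≤ m) (hn : 0 ≤ n)
    (hA : 0 ≤ A) (hB : 0 ≤ B) (hC : 0 ≤ C) (hlmn : l + m + n = 1) (hx : x ^ 2 ≤ l * A)
    (hy : y ^ 2 ≤ m * B) (hz : z ^ 2 ≤ n * C) (hABC : A + B + C = D ^ 2) (hD : 0 ≤ D)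
    (hxyz : D ≤ x + y + z) : y = m * D := by
  -- `A - 2 * D * x + l * D ^ 2` is the Cauchy-Schwarz defect against constant speed `D`. The three
  -- defects are nonnegative and sum to `2 * D * (D - (x + y + z)) ≤ 0`, so all vanish.
  have key : ∀ {x l A : ℝ}, 0 ≤ l → 0 ≤ A → x ^ 2 ≤ l * A →
      (x - l * D) ^ 2 ≤ l * (A - 2 * D * x + l * D ^ 2) ∧ 0 ≤ A - 2 * D * x + l * D ^ 2 := by
    intro x l A hl hA hx
    have h1 : (x - l * D) ^ 2 ≤ l * (A - 2 * D * x + l * D ^ 2) := by nlinarith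
    refine ⟨h1, ?_⟩
    rcases hl.eq_or_lt with rfl | hl
    · have : x = 0 := by nlinarith [sq_nonneg x]
      simp [this, hA]
    · exact nonneg_of_mul_nonneg_right ((sq_nonneg _).trans h1) hl
  obtain ⟨-, k1⟩ := key hl hA hx
  obtain ⟨h2, k2⟩ := key hm hB hy
  obtain ⟨-, k3⟩ := key hn hC hz
  have hsum : (A - 2 * D * x + l * D ^ 2) + (B - 2 * D * y + m * D ^ 2)
      + (C - 2 * D * z + n * D ^ 2) ≤ 0 := by
    have : (A - 2 * D * x + l * D ^ 2) + (B - 2 * D * y + m * D ^ 2)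
      + (C - 2 * D * z + n * D ^ 2) = 2 * D * (D - (x + y + z)) := by
      linear_combination hABC + D ^ 2 * hlmn
    rw [this]
    nlinarith
  have h0 : B - 2 * D * y + m * D ^ 2 = 0 := by linarith
  rw [h0, mul_zero] at h2
  have := pow_eq_zero_iff (two_ne_zero) |>.1 (le_antisymm h2 (sq_nonneg _))
  linarith

/-- On each of the pieces cut at `s` and `t`, the squared distance is at most duration times action.
The actions sum to the squared total distance, which leaves no slack in the triangle inequality. -/
lemma IsPath.diffDist_eq_of_minimal (h : IsPath δ 0 1 ρ w) (hD : diffDist δ (ρ 0) (ρ 1) ≠ ⊤)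
    (hmin : actionOn δ (Icc 0 1) ρ w = diffDist δ (ρ 0) (ρ 1) ^ 2) {s t : ℝ} (hs : 0 ≤ s)
    (hst : s ≤ t) (ht : t ≤ 1) :
    diffDist δ (ρ s) (ρ t) = ENNReal.ofReal (t - s) * diffDist δ (ρ 0) (ρ 1) := by
  have hsplit : actionOn δ (Icc 0 1) ρ w = actionOn δ (Icc 0 s) ρ w + actionOn δ (Icc s t) ρ w
      + actionOn δ (Icc t 1) ρ w := by
    rw [actionOn_union (hs.trans hst) ht, actionOn_union hs hst]
  have htop : actionOn δ (Icc 0 1) ρ w ≠ ⊤ := by rw [hmin]; exact ENNReal.pow_ne_top hD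
  rw [hsplit] at htop hmin
  have hA := ne_top_of_le_ne_top htop (le_self_add.trans le_self_add)
  have hB := ne_top_of_le_ne_top htop (le_add_self.trans le_self_add)
  have hC := ne_top_of_le_ne_top htop le_add_self
  have piece : ∀ {p q : ℝ}, 0 ≤ p → p ≤ q → q ≤ 1 → actionOn δ (Icc p q) ρ w ≠ ⊤ →
      diffDist δ (ρ p) (ρ q) ≠ ⊤ ∧ (diffDist δ (ρ p) (ρ q)).toReal ^ 2
        ≤ (q - p) * (actionOn δ (Icc p q) ρ w).toReal := by
    intro p q hp hpq hq hfin
    have h1 := diffDist_sq_le' hpq (h.mono hp hq)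
    have h2 := ENNReal.mul_ne_top (ENNReal.ofReal_ne_top (r := q - p)) hfin
    refine ⟨fun hh => ?_, ?_⟩
    · rw [hh] at h1
      exact h2 (top_le_iff.1 (by simpa using h1))
    · have := ENNReal.toReal_mono h2 h1
      rwa [ENNReal.toReal_pow, ENNReal.toReal_mul, ENNReal.toReal_ofReal (by linarith)] at this
  obtain ⟨fx, hx⟩ := piece le_rfl hs (hst.trans ht) hA
  obtain ⟨fy, hy⟩ := piece hs hst ht hB
  obtain ⟨fz, hz⟩ := piece (hs.trans hst) ht le_rfl hC
  have htri := (diffDist_triangle δ (ρ 0) (ρ t) (ρ 1)).trans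
    (add_le_add_left (diffDist_triangle δ (ρ 0) (ρ s) (ρ t)) _)
  have htri' := ENNReal.toReal_mono (by simp [fx, fy, fz]) htri
  rw [ENNReal.toReal_add (by simp [fx, fy]) fz, ENNReal.toReal_add fx fy] at htri'
  have hmin' := congrArg ENNReal.toReal hmin
  rw [ENNReal.toReal_pow, ENNReal.toReal_add (by simp [hA, hB]) hC, ENNReal.toReal_add hA hB]
    at hmin'
  have hfinal := eq_mul_of_sq_le_mul (by linarith) (sub_nonneg.2 hst) (by linarith)
    ENNReal.toReal_nonneg ENNReal.toReal_nonneg ENNReal.toReal_nonneg (by ring) hx hy hz hmin'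
    ENNReal.toReal_nonneg htri'
  rw [← ENNReal.ofReal_toReal fy, hfinal, ENNReal.ofReal_mul (sub_nonneg.2 hst),
    ENNReal.ofReal_toReal hD]

lemma diffDist_lt_top_of_mem_finiteSet {r : ℤ → ℝ} (ha : a ∈ finiteSet δ r)
    (hb : b ∈ finiteSet δ r) : diffDist δ a b < ⊤ := by
  refine (diffDist_triangle δ a r b).trans_lt (ENNReal.add_lt_top.2 ⟨ha.2, ?_⟩)
  rw [diffDist_comm]
  exact hb.2

end DiffusiveTransport

end

theorem mainTheorem1 (δ : ℝ) (hδ : 0 < δ) (ρstar : ℤ → ℝ)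
    (hρstar : ρstar ∈ DiffusiveTransport.densities δ) :
    -- the distance is a (finite) metric on the set of densities at finite distance from `ρstar`
    ((∀ a ∈ DiffusiveTransport.finiteSet δ ρstar, ∀ b ∈ DiffusiveTransport.finiteSet δ ρstar,
        DiffusiveTransport.diffDist δ a b < ∞ ∧
        (DiffusiveTransport.diffDist δ a b = 0 ↔ a = b) ∧
        DiffusiveTransport.diffDist δ a b = DiffusiveTransport.diffDist δ b a) ∧
      (∀ a ∈ DiffusiveTransport.finiteSet δ ρstar, ∀ b ∈ DiffusiveTransport.finiteSet δ ρstar,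
        ∀ c ∈ DiffusiveTransport.finiteSet δ ρstar,
        DiffusiveTransport.diffDist δ a c ≤
          DiffusiveTransport.diffDist δ a b + DiffusiveTransport.diffDist δ b c)) ∧
    -- any two points are connected by a minimizer, whose density component is a geodesic
    (∀ a ∈ DiffusiveTransport.finiteSet δ ρstar, ∀ b ∈ DiffusiveTransport.finiteSet δ ρstar,
      ∃ ρ w : ℝ → ℤ → ℝ,
        (ρ, w) ∈ DiffusiveTransport.connections δ a b ∧
        (∀ c ∈ DiffusiveTransport.connections δ a b,
          DiffusiveTransport.action δ (ρ, w) ≤ DiffusiveTransport.action δ c) ∧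
        DiffusiveTransport.action δ (ρ, w) = DiffusiveTransport.diffDist δ a b ^ 2 ∧
        (∀ s ∈ Icc (0 : ℝ) 1, ρ s ∈ DiffusiveTransport.finiteSet δ ρstar) ∧
        (∀ s ∈ Icc (0 : ℝ) 1, ∀ t ∈ Icc (0 : ℝ) 1,
          DiffusiveTransport.diffDist δ (ρ s) (ρ t) =
            ENNReal.ofReal |s - t| * DiffusiveTransport.diffDist δ a b)) := by
  refine ⟨⟨fun a ha b hb => ⟨?_, ⟨?_, ?_⟩, ?_⟩, fun a _ b _ c _ => ?_⟩, fun a ha b hb => ?_⟩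
  · exact DiffusiveTransport.diffDist_lt_top_of_mem_finiteSet ha hb
  · exact DiffusiveTransport.eq_of_diffDist_eq_zero hδ
  · rintro rfl
    exact DiffusiveTransport.diffDist_self ha.1
  · exact DiffusiveTransport.diffDist_comm δ a b
  · exact DiffusiveTransport.diffDist_triangle δ a b c
  · have hfin := (DiffusiveTransport.diffDist_lt_top_of_mem_finiteSet ha hb).ne
    obtain ⟨ρ, w, hp, h0, h1, hmin⟩ := DiffusiveTransport.exists_minimizer hδ hfin
    have hgeo : ∀ s t : ℝ, 0 ≤ s → s ≤ t → t ≤ 1 → DiffusiveTransport.diffDist δ (ρ s) (ρ t)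
        = ENNReal.ofReal (t - s) * DiffusiveTransport.diffDist δ a b := by
      intro s t hs hst ht
      rw [← h0, ← h1]
      rw [← h0, ← h1] at hmin hfin
      exact hp.diffDist_eq_of_minimal hfin hmin hs hst ht
    refine ⟨ρ, w, DiffusiveTransport.mem_connections_iff.2 ⟨hp, h0, h1⟩, fun c hc => ?_, hmin,
      fun s hs => ⟨hp.mem_densities s hs, ?_⟩, fun s hs t ht => ?_⟩
    · refine hmin.le.trans ?_
      rw [DiffusiveTransport.diffDist_sq]
      exact iInf₂_le c hc
    -- The geodesic identity bounds the distance from `ρ s` to `a`, and `a` is at finite distance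
    -- from `ρstar`.
    · refine (DiffusiveTransport.diffDist_triangle δ (ρ s) a ρstar).trans_lt
        (ENNReal.add_lt_top.2 ⟨?_, ha.2⟩)
      rw [DiffusiveTransport.diffDist_comm]
      have := hgeo 0 s le_rfl hs.1 hs.2
      rw [h0] at this
      rw [this]
      exact ENNReal.mul_lt_top ENNReal.ofReal_lt_top hfin.lt_top
    · rcases le_total s t with hst | hst
      · rw [hgeo s t hs.1 hst ht.2, abs_sub_comm, abs_of_nonneg (sub_nonneg.2 hst)]
      · rw [DiffusiveTransport.diffDist_comm, hgeo t s ht.1 hst hs.2,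
          abs_of_nonneg (sub_nonneg.2 hst)]
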